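/- **Setting.** Logarithms are base 2 unless written $\ln$; $\mathrm{KL}$ and mutual information are in bits. A *membership tester* $\mathcal M$ for universe $[u]$ and key size $n$ consists of shared randomness $R$ (independent of the key set), a possibly randomized map $\mathsf{Init}$ sending a key set $\mathcal K\subseteq[u]$, $|\mathcal K|=n$, and $R$ to a memory state $W$, and a possibly randomized map $\mathsf{Query}$ sending $i\in[u]$, $W$ and $R$ to a score $\hat x_i\in[0,1]$. Its memory budget $B(\mathcal M)$ is the information about a uniformly random key set $\mathcal K$ held in the memory, $B(\mathcal M)=I(W;\mathcal K\mid R)=I((W,R);\mathcal K)$ (which is $I(W;\mathcal K)$ when there is no shared randomness). Testers are permutation-invariant: the law of the answer to query $i$ on key set $\mathcal K$ equals that to query $\pi(i)$ on key set $\pi(\mathcal K)$ for every permutation $\pi$ of $[u]$. Hence this law depends only on whether $i\in\mathcal K$; it is denoted $\mu_K(\mathcal M)$ if $i\in\mathcal K$ and $\mu_N(\mathcal M)$ if $i\notin\mathcal K$. Let $d^K,d^N:[0,1]\to[0,\infty]$ be lower semicontinuous with $d^K(1)=d^N(0)=0$ and with some $c\in[0,1]$ such that $d^K(c),d^N(c)<\infty$,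 and let $\varepsilon_K,\varepsilon_N\in[0,\infty)$. Put $\mathcal C_K=\{\mu\in\mathcal P([0,1]):\mathbb E_\mu[d^K]\le\varepsilon_K\}$ and $\mathcal C_N=\{\mu\in\mathcal P([0,1]):\mathbb E_\mu[d^N]\le\varepsilon_N\}$. **Theorem.** Suppose $(\mu_K^*,\mu_N^*)$ is the unique minimizer of $\mathrm{KL}(\mu_K\|\mu_N)$ over $\mathcal C_K\times\mathcal C_N$, that the support $\mathcal X$ of $\mu_N^*$ is finite, and that $\chi^2(\mu_K^*\|\mu_N^*)<\infty$. For a rational $p\in(0,1)$, call a sequence of permutation-invariant membership testers $\mathcal M_j$ for key sizes $n_j$ and universes $[u_j]$ *admissible for $p$* if $n_j,u_j\to\infty$, $n_j/u_j=p$ for all $j$, all query outputs of $\mathcal M_j$ lie in $\mathcal X$, and $$\limsup_{j\to\infty}\mathbb E_{\mu_K(\mathcal M_j)}[d^K]\le\varepsilon_K,\qquad \limsup_{j\to\infty}\mathbb E_{\mu_N(\mathcal M_j)}[d^N]\le\varepsilon_N .$$ Then there is a function $r$ with $r(p)=o(p)$ as $p\to0^+$, depending only on the data fixed above, such that for every rational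 $p\in(0,1)$: 1. (lower bound) every sequence admissible for $p$ satisfies $$\liminf_{j\to\infty}\frac{B(\mathcal M_j)}{n_j}\ \ge\ \mathrm{KL}(\mu_K^*\|\mu_N^*)-\frac{\chi^2(\mu_K^*\|\mu_N^*)}{2\ln 2}\,p+r(p);$$ 2. (achievability) some sequence admissible for $p$ satisfies $$\limsup_{j\to\infty}\frac{B(\mathcal M_j)}{n_j}\ \le\ \mathrm{KL}(\mu_K^*\|\mu_N^*)-\frac{\chi^2(\mu_K^*\|\mu_N^*)}{2\ln 2}\,p+r(p).$$ -/

import Mathlib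

open MeasureTheory ProbabilityTheory Filter Topology Asymptotics
open scoped ENNReal NNReal

noncomputable section

/-! ### Divergences and mutual information -/

/-- Base-2 Kullback-Leibler divergence of two probability measures. -/
def klBits {α : Type*} [MeasurableSpace α] (μ ν : Measure α) : ℝ≥0∞ :=
  InformationTheory.klDiv μ ν / ENNReal.ofReal (Real.log 2)

open scoped Classical in
/-- The chi-squared divergence: the integral of `(dμ/dν - 1) ^ 2` against `ν` if `μ ≪ ν`,
and `∞` otherwise. -/
def chiSqDiv {α : Type*} [MeasurableSpace α] (μ ν : Measure α) : ℝ≥0∞ :=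
  if μ ≪ ν then ∫⁻ x, ENNReal.ofReal (((μ.rnDeriv ν x).toReal - 1) ^ 2) ∂ν else ∞

/-- The mutual information, in bits, of a pair of random variables with joint law `P`:
the divergence of the joint law from the product of its marginals. -/
def mutualInfoBits {α β : Type*} [MeasurableSpace α] [MeasurableSpace β]
    (P : Measure (α × β)) : ℝ≥0∞ :=
  klBits P (P.fst.prod P.snd)

/-! ### Key sets -/

/-- Key sets: subsets of size `n` of the universe `Fin u`. -/
abbrev KeySet (u n : ℕ) : Type := {K : Finset (Fin u) // K.card = n}

instance KeySet.instMeasurableSpace (u n : ℕ) : MeasurableSpace (KeySet u n) := ⊤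

instance KeySet.instDiscrete (u n : ℕ) : DiscreteMeasurableSpace (KeySet u n) :=
  ⟨fun _ => trivial⟩

/-- The image of a key set under a permutation of the universe. -/
def KeySet.permute {u n : ℕ} (π : Equiv.Perm (Fin u)) (K : KeySet u n) : KeySet u n :=
  ⟨K.1.map π.toEmbedding, by simp [K.2]⟩

/-! ### Membership testers -/

/-- A membership tester for universe `Fin u` and key size `n`.  The shared randomness (`Seed`) is
drawn independently of the key set and is visible to both algorithms.  `init` maps the key set and
the shared randomness to a (possibly randomized) memory state, and `query` maps an element of the
universe, the shared randomness and the memory state to a (possibly randomized) score in `[0,1]`. -/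
structure MembershipTester (u n : ℕ) where
  Seed : Type
  State : Type
  [seedSpace : MeasurableSpace Seed]
  [stateSpace : MeasurableSpace State]
  seedLaw : Measure Seed
  [isProb_seedLaw : IsProbabilityMeasure seedLaw]
  init : KeySet u n → Kernel Seed State
  [isMarkov_init : ∀ K, IsMarkovKernel (init K)]
  query : Fin u → Kernel (Seed × State) unitInterval
  [isMarkov_query : ∀ i, IsMarkovKernel (query i)]

namespace MembershipTester

attribute [instance] seedSpace stateSpace isProb_seedLaw isMarkov_init isMarkov_query

variable {u n : ℕ} (M : MembershipTester u n)

/-- Joint law of the shared randomness and the memory state when the key set is `K`. -/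
def memoryLaw (K : KeySet u n) : Measure (M.Seed × M.State) := M.seedLaw ⊗ₘ M.init K

/-- `memoryLaw` as a Markov kernel (the space of key sets is finite and discrete). -/
def memoryKernel : Kernel (KeySet u n) (M.Seed × M.State) where
  toFun := M.memoryLaw
  measurable' := Measurable.of_discrete

instance (K : KeySet u n) : IsProbabilityMeasure (M.memoryLaw K) := by
  unfold memoryLaw
  infer_instance

instance : IsMarkovKernel M.memoryKernel :=
  ⟨fun K => inferInstanceAs (IsProbabilityMeasure (M.memoryLaw K))⟩

/-- Joint law of `(𝒦, (R, W))`, where the key set `𝒦` is uniformly random among the sets of size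
`n`, `R` is the shared randomness and `W` is the memory state. -/
def jointLaw : Measure (KeySet u n × (M.Seed × M.State)) :=
  uniformOn (Set.univ : Set (KeySet u n)) ⊗ₘ M.memoryKernel

/-- The memory budget in bits: the information about the uniformly random key set held in the
memory state `W`, to which the shared randomness `R` is available as side information.  As `R` is
independent of `𝒦`, this is `I(𝒦; (R, W)) = I(𝒦; W | R)`, and it is `I(𝒦; W)` if there is no
shared randomness. -/
def budget : ℝ≥0∞ := mutualInfoBits M.jointLaw

/-- Law of the answer to the query `i` when the key set is `K`. -/
def outputLaw (K : KeySet u n) (i : Fin u) : Measure unitInterval :=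
  (M.memoryLaw K).bind (M.query i)

/-- The law of the answer to a query is unaffected by permutations of the universe. -/
def PermutationInvariant : Prop :=
  ∀ (π : Equiv.Perm (Fin u)) (K : KeySet u n) (i : Fin u),
    M.outputLaw K i = M.outputLaw (K.permute π) (π i)

/-- The query output distribution on keys: the average of the law of the answer over all pairs of
a key set and one of its elements.  For a permutation-invariant tester all these laws coincide, see
`keyLaw_eq_outputLaw`. -/
def keyLaw : Measure unitInterval :=
  let S := (Finset.univ : Finset (KeySet u n × Fin u)).filter (fun q => q.2 ∈ q.1.1)
  (S.card : ℝ≥0∞)⁻¹ • ∑ q ∈ S, M.outputLaw q.1 q.2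

/-- The query output distribution on non-keys; see `nonkeyLaw_eq_outputLaw`. -/
def nonkeyLaw : Measure unitInterval :=
  let S := (Finset.univ : Finset (KeySet u n × Fin u)).filter (fun q => q.2 ∉ q.1.1)
  (S.card : ℝ≥0∞)⁻¹ • ∑ q ∈ S, M.outputLaw q.1 q.2

/-- Expected error on keys under the error metric `dK`. -/
def keyError (dK : unitInterval → ℝ≥0∞) : ℝ≥0∞ := ∫⁻ x, dK x ∂M.keyLaw

/-- Expected error on non-keys under the error metric `dN`. -/
def nonkeyError (dN : unitInterval → ℝ≥0∞) : ℝ≥0∞ := ∫⁻ x, dN x ∂M.nonkeyLaw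

/-- Every answer to a query lies in `X`. -/
def OutputsIn (X : Set unitInterval) : Prop :=
  ∀ (i : Fin u) (z : M.Seed × M.State), M.query i z Xᶜ = 0

lemma average_const {ι : Type*} (S : Finset ι) (hS : S.Nonempty)
    (f : ι → Measure unitInterval) (ν : Measure unitInterval) (h : ∀ q ∈ S, f q = ν) :
    (S.card : ℝ≥0∞)⁻¹ • ∑ q ∈ S, f q = ν := by
  rw [Finset.sum_congr rfl h, Finset.sum_const, ← Nat.cast_smul_eq_nsmul ℝ≥0∞, smul_smul,
    ENNReal.inv_mul_cancel, one_smul]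
  · simpa using hS.ne_empty
  · exact ENNReal.natCast_ne_top _

lemma exists_perm_key (K K' : KeySet u n) (i i' : Fin u) (hi : i ∈ K.1) (hi' : i' ∈ K'.1) :
    ∃ π : Equiv.Perm (Fin u), K'.permute π = K ∧ π i' = i := by
  let e₀ : {x // x ∈ K'.1} ≃ {x // x ∈ K.1} := Finset.equivOfCardEq (K'.2.trans K.2.symm)
  let e := e₀.trans (Equiv.swap (e₀ ⟨i', hi'⟩) ⟨i, hi⟩)
  refine ⟨e.extendSubtype, ?_, ?_⟩
  · apply Subtype.ext
    apply Finset.eq_of_subset_of_card_le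
    · intro x hx
      simp only [KeySet.permute, Finset.mem_map] at hx
      obtain ⟨y, hy, rfl⟩ := hx
      exact e.extendSubtype_mem y hy
    · simp [KeySet.permute, K.2, K'.2]
  · rw [e.extendSubtype_apply_of_mem i' hi']
    simp [e]

lemma exists_perm_nonkey (K K' : KeySet u n) (i i' : Fin u) (hi : i ∉ K.1)
    (hi' : i' ∉ K'.1) : ∃ π : Equiv.Perm (Fin u), K'.permute π = K ∧ π i' = i := by
  let e₁ : {x // x ∈ K'.1} ≃ {x // x ∈ K.1} := Finset.equivOfCardEq (K'.2.trans K.2.symm)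
  let π₁ : Equiv.Perm (Fin u) := e₁.extendSubtype
  have hπ₁ : π₁ i' ∉ K.1 := e₁.extendSubtype_not_mem i' hi'
  refine ⟨π₁.trans (Equiv.swap (π₁ i') i), ?_, by simp⟩
  apply Subtype.ext
  apply Finset.eq_of_subset_of_card_le
  · intro x hx
    simp only [KeySet.permute, Finset.mem_map] at hx
    obtain ⟨y, hy, rfl⟩ := hx
    have h1 : π₁ y ∈ K.1 := e₁.extendSubtype_mem y hy
    have h2 : π₁ y ≠ π₁ i' := fun h => hπ₁ (h ▸ h1)
    have h3 : π₁ y ≠ i := fun h => hi (h ▸ h1)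
    simpa [Equiv.swap_apply_of_ne_of_ne h2 h3] using h1
  · simp [KeySet.permute, K.2, K'.2]

/-- For a permutation-invariant tester, `keyLaw` is the law of the answer to any query on a key. -/
theorem keyLaw_eq_outputLaw (hM : M.PermutationInvariant) (K : KeySet u n) (i : Fin u)
    (hi : i ∈ K.1) : M.keyLaw = M.outputLaw K i := by
  refine average_const _ ⟨(K, i), by simpa using hi⟩ _ _ ?_
  rintro ⟨K', i'⟩ hq
  obtain ⟨π, rfl, rfl⟩ := exists_perm_key K K' i i' hi (by simpa using hq)
  exact hM π K' i'

/-- For a permutation-invariant tester, `nonkeyLaw` is the law of the answer to any query on a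
non-key. -/
theorem nonkeyLaw_eq_outputLaw (hM : M.PermutationInvariant) (K : KeySet u n) (i : Fin u)
    (hi : i ∉ K.1) : M.nonkeyLaw = M.outputLaw K i := by
  refine average_const _ ⟨(K, i), by simpa using hi⟩ _ _ ?_
  rintro ⟨K', i'⟩ hq
  obtain ⟨π, rfl, rfl⟩ := exists_perm_nonkey K K' i i' hi (by simpa using hq)
  exact hM π K' i'

end MembershipTester

/-! ### Error metrics, feasible output distributions, testers under consideration -/

/-- Standing assumptions on the error metrics for keys and non-keys. -/
structure IsErrorMetricPair (dK dN : unitInterval → ℝ≥0∞) : Prop where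
  lsc_key : LowerSemicontinuous dK
  lsc_nonkey : LowerSemicontinuous dN
  key_one : dK 1 = 0
  nonkey_zero : dN 0 = 0
  exists_finite : ∃ c, dK c < ∞ ∧ dN c < ∞

/-- Output distributions with expected error at most `ε` under the error metric `d`. -/
def feasible (d : unitInterval → ℝ≥0∞) (ε : ℝ≥0) : Set (ProbabilityMeasure unitInterval) :=
  {μ | ∫⁻ x, d x ∂(μ : Measure unitInterval) ≤ ε}

/-- `(μK, μN)` is the unique minimizer of the divergence over all feasible pairs. -/
structure IsUniqueKLMinimizer (dK dN : unitInterval → ℝ≥0∞) (εK εN : ℝ≥0)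
    (μK μN : ProbabilityMeasure unitInterval) : Prop where
  mem_key : μK ∈ feasible dK εK
  mem_nonkey : μN ∈ feasible dN εN
  le : ∀ νK ∈ feasible dK εK, ∀ νN ∈ feasible dN εN,
    klBits (μK : Measure unitInterval) μN ≤ klBits (νK : Measure unitInterval) νN
  unique : ∀ νK ∈ feasible dK εK, ∀ νN ∈ feasible dN εN,
    klBits (νK : Measure unitInterval) νN = klBits (μK : Measure unitInterval) μN →
      νK = μK ∧ νN = μN

/-- A sequence of permutation-invariant testers with outputs in `X`, key sizes `n j → ∞`, universe
sizes `u j → ∞`, fixed key density `n j / u j = p`, and expected errors asymptotically at most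
`εK` and `εN`. -/
structure IsTesterSequence (dK dN : unitInterval → ℝ≥0∞) (εK εN : ℝ≥0) (X : Set unitInterval)
    (p : ℚ) (n u : ℕ → ℕ) (M : ∀ j, MembershipTester (u j) (n j)) : Prop where
  tendsto_n : Tendsto n atTop atTop
  tendsto_u : Tendsto u atTop atTop
  density : ∀ j, (n j : ℚ) / (u j : ℚ) = p
  invariant : ∀ j, (M j).PermutationInvariant
  outputsIn : ∀ j, (M j).OutputsIn X
  keyError_le : limsup (fun j => (M j).keyError dK) atTop ≤ (εK : ℝ≥0∞)
  nonkeyError_le : limsup (fun j => (M j).nonkeyError dN) atTop ≤ (εN : ℝ≥0∞)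

end

/-! For fixed `p` the problem has a single-letter answer. Let `J_p(a, b)` (`jsInfo`) be the
information in nats that one answer carries about a Bernoulli(`p`) key bit, when answers have law
`a` on keys and `b` on non-keys, and let `m = p a + (1 - p) b` be the mixture. The asymptotic
optimum per key is the minimum of `J_p(a, b) / p` over feasible pairs, divided by `ln 2` to pass to
bits.

Lower bound (`klDiv_jointLaw_ge`): in the Donsker-Varadhan inequality for the joint law of key set
and memory, the test function is the sum over all queries of the expected log-likelihood ratio of
the answer. Its mean needs only the one-query laws. For its exponential moment, a uniform set of
size `n` is compared with independent Bernoulli(`p`) keys, for which the average factorizes.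
Conditioning on the size being `n` costs a factor at most `u + 1`, because the binomial mode has
probability at least `1 / (u + 1)`. The resulting loss `log (u + 1)` is `o(n)`.

Achievability (`klDiv_jointLaw_independentTester_le`): store independent answers to all queries and
bound the information by the average divergence from the product of the mixtures `m`. This gives at
most `u * J_p(a, b)`.

Expansion (`isLittleO_jsInfo_minimizer`): `J_p(a, b) = p KL(a‖b) - KL(m‖b)`, and the second term is
`p² χ²(a‖b) / 2` to leading order. Evaluating at the optimal pair bounds the minimum from above.
From below, compactness and uniqueness force the minimizers of `J_p` to converge to the optimal
pair, so their chi-squared terms converge as well, while their divergence is at least the optimal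
one. The remainder `r` is the exact minimum minus the two-term expansion. -/

section WeightFunctions

/-! ### Information functionals on weight vectors and their expansion as `p → 0`. -/

variable {ι : Type*} [Fintype ι]

/-- The information, in nats, about a Bernoulli variable of parameter `p` carried by a symbol with
weights `a` if the variable is `1` and weights `b` if it is `0`. -/
noncomputable def jsInfo (p : ℝ) (a b : ι → ℝ) : ℝ :=
  ∑ x, (p * (a x * Real.log (a x)) + (1 - p) * (b x * Real.log (b x))
    - (p * a x + (1 - p) * b x) * Real.log (p * a x + (1 - p) * b x))

/-- The divergence, in nats, of two weight functions on a finite type. -/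
noncomputable def klSum (a b : ι → ℝ) : ℝ := ∑ x, a x * Real.log (a x / b x)

/-- The chi-squared divergence of two weight functions on a finite type. -/
noncomputable def chiSum (a b : ι → ℝ) : ℝ := ∑ x, b x * (a x / b x - 1) ^ 2

lemma continuous_jsInfo (p : ℝ) :
    Continuous fun q : (ι → ℝ) × (ι → ℝ) => jsInfo p q.1 q.2 := by
  unfold jsInfo
  have h := Real.continuous_mul_log
  refine continuous_finsetSum _ fun x _ => ?_
  refine ((continuous_const.mul (h.comp (by fun_prop : Continuous fun q : (ι → ℝ) × (ι → ℝ) =>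
    q.1 x))).add (continuous_const.mul (h.comp (by fun_prop : Continuous
      fun q : (ι → ℝ) × (ι → ℝ) => q.2 x)))).sub
    (h.comp (by fun_prop : Continuous fun q : (ι → ℝ) × (ι → ℝ) => p * q.1 x + (1 - p) * q.2 x))

/-- This is `log t ≤ t - 1` at `t = g * m / a`. The free parameter `g` turns a divergence into a
supremum of expressions linear in `(a, m)`; equality holds at `g = a / m`. -/
lemma mul_log_sub_mul_log_ge {a m g : ℝ} (ha : 0 ≤ a) (hm : 0 ≤ m) (hg : 0 < g)
    (h : m = 0 → a = 0) :
    a * Real.log g - g * m + a ≤ a * Real.log a - a * Real.log m := by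
  rcases ha.eq_or_lt with rfl | ha
  · simp only [zero_mul, zero_sub, add_zero, sub_zero]
    have := mul_nonneg hg.le hm
    linarith
  · have hm : 0 < m := lt_of_le_of_ne hm fun h' => ha.ne' (h h'.symm)
    have h1 := Real.log_le_sub_one_of_pos (x := g * m / a) (by positivity)
    rw [Real.log_div (by positivity) ha.ne', Real.log_mul hg.ne' hm.ne'] at h1
    have h2 := mul_le_mul_of_nonneg_left h1 ha.le
    have h3 : a * (g * m / a - 1) = g * m - a := by field_simp
    linarith [h2, h3]

/-- The tangent inequality is used with parameter `g` on keys and `1` on non-keys. After division by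
`p` the bound is continuous in `(p, a, b)` up to `p = 0`, which replaces semicontinuity of the
divergence in the limit argument. -/
lemma le_jsInfo {p : ℝ} (hp : p ∈ Set.Ioo (0 : ℝ) 1) {a b : ι → ℝ} (ha : a ∈ stdSimplex ℝ ι)
    (hb : b ∈ stdSimplex ℝ ι) {g : ι → ℝ} (hg : ∀ x, 0 < g x) :
    p * ∑ x, (a x * Real.log (g x) - g x * (p * a x + (1 - p) * b x) + a x)
      ≤ jsInfo p a b := by
  have hp0 := hp.1
  have hp1 : 0 < 1 - p := by linarith [hp.2]
  -- The non-key bound totals zero, since `b` and the mixture both have mass one.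
  have hsum : ∑ x, (1 - p) * (b x - (p * a x + (1 - p) * b x)) = 0 := by
    rw [← Finset.mul_sum, Finset.sum_sub_distrib, Finset.sum_add_distrib, ← Finset.mul_sum,
      ← Finset.mul_sum, ha.2, hb.2]
    ring
  rw [← add_zero (p * _), ← hsum, Finset.mul_sum, ← Finset.sum_add_distrib]
  refine Finset.sum_le_sum fun x _ => ?_
  have hax := ha.1 x
  have hbx := hb.1 x
  set m := p * a x + (1 - p) * b x with hm
  have hm0 : 0 ≤ m := by positivity
  have h1 := mul_log_sub_mul_log_ge hax hm0 (hg x) (fun h => by nlinarith [mul_nonneg hp1.le hbx])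
  have h2 := mul_log_sub_mul_log_ge hbx hm0 one_pos
    (fun h => by nlinarith [mul_nonneg hp0.le hax])
  simp only [Real.log_one] at h2
  have h3 := mul_le_mul_of_nonneg_left h1 hp0.le
  have h4 := mul_le_mul_of_nonneg_left h2 hp1.le
  have h5 : p * (a x * Real.log (a x)) + (1 - p) * (b x * Real.log (b x)) - m * Real.log m
      = p * (a x * Real.log (a x) - a x * Real.log m)
        + (1 - p) * (b x * Real.log (b x) - b x * Real.log m) := by
    rw [hm]; ring
  rw [h5]
  linarith

/-- The compensation identity for the Jensen-Shannon information. -/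
lemma jsInfo_eq {p : ℝ} (hp : p ∈ Set.Ioo (0 : ℝ) 1) {a b : ι → ℝ} (ha : a ∈ stdSimplex ℝ ι)
    (hb : b ∈ stdSimplex ℝ ι) (hpos : ∀ x, 0 < b x) :
    jsInfo p a b = p * klSum a b
      - ∑ x, b x * InformationTheory.klFun (1 + p * (a x / b x - 1)) := by
  have hp0 := hp.1
  have hp1 : 0 < 1 - p := by linarith [hp.2]
  have hsum : ∑ x, (b x - (p * a x + (1 - p) * b x)) = 0 := by
    rw [Finset.sum_sub_distrib, Finset.sum_add_distrib, ← Finset.mul_sum,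
      ← Finset.mul_sum, ha.2, hb.2]
    ring
  rw [← add_zero (p * klSum a b - _), ← hsum, klSum, Finset.mul_sum, ← Finset.sum_sub_distrib,
    ← Finset.sum_add_distrib]
  refine Finset.sum_congr rfl fun x _ => ?_
  have hax := ha.1 x
  have hbx := hpos x
  have hm0 : 0 < p * a x + (1 - p) * b x := by positivity
  -- The argument of `klFun` is the density of the mixture against `b`, so the subtracted sum is the
  -- divergence of the mixture from `b`.
  have h1 : 1 + p * (a x / b x - 1) = (p * a x + (1 - p) * b x) / b x := by
    field_simp; ring
  rw [h1, InformationTheory.klFun_apply, Real.log_div hm0.ne' hbx.ne']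
  rcases hax.eq_or_lt with h0 | h0
  · rw [← h0]; field_simp; simp; ring
  · rw [Real.log_div h0.ne' hbx.ne']; field_simp; ring

lemma jsInfo_le {p : ℝ} (hp : p ∈ Set.Ioo (0 : ℝ) 1) {a b : ι → ℝ} (ha : a ∈ stdSimplex ℝ ι)
    (hb : b ∈ stdSimplex ℝ ι) (hpos : ∀ x, 0 < b x) : jsInfo p a b ≤ p * klSum a b := by
  rw [jsInfo_eq hp ha hb hpos, sub_le_self_iff]
  refine Finset.sum_nonneg fun x _ => mul_nonneg (hpos x).le (InformationTheory.klFun_nonneg ?_)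
  have h1 : 0 ≤ p * (a x / b x) := mul_nonneg hp.1.le (div_nonneg (ha.1 x) (hpos x).le)
  linarith [hp.2]

/-- Taylor expansion at `1`. The logarithm error contributes `3/2 * 2` and the cubic leftover `1/2`,
so `4` is a rounded-up constant. -/
lemma abs_klFun_one_add_sub_le {s : ℝ} (hs : |s| ≤ 1 / 2) :
    |InformationTheory.klFun (1 + s) - s ^ 2 / 2| ≤ 4 * |s| ^ 3 := by
  have h1 := Real.abs_log_sub_add_sum_range_le (x := -s) (by rw [abs_neg]; linarith) 2
  simp only [Finset.sum_range_succ, Finset.sum_range_zero, abs_neg, sub_neg_eq_add] at h1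
  norm_num at h1
  have h2 : |s| ^ 3 / (1 - |s|) ≤ 2 * |s| ^ 3 := by
    rw [div_le_iff₀ (by linarith)]
    nlinarith [pow_nonneg (abs_nonneg s) 3]
  have h3 : InformationTheory.klFun (1 + s) - s ^ 2 / 2
      = (1 + s) * (-s + s ^ 2 / 2 + Real.log (1 + s)) - s ^ 3 / 2 := by
    rw [InformationTheory.klFun_apply]; ring
  rw [h3]
  refine (abs_sub _ _).trans ?_
  rw [abs_mul, abs_div, abs_pow, abs_two]
  have h4 : |1 + s| ≤ 3 / 2 := by
    refine (abs_add_le _ _).trans ?_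
    rw [abs_one]; linarith
  have h5 := mul_le_mul h4 (h1.trans h2) (abs_nonneg _) (by norm_num)
  nlinarith [pow_nonneg (abs_nonneg s) 3]

/-- The perturbation `t` varies with `p` because it will be the likelihood ratio of a minimizer that
depends on `p`. -/
lemma tendsto_klFun_one_add_div {l : Filter ℝ} (hl : l ≤ 𝓝[>] 0) {t : ℝ → ℝ} {t₀ : ℝ}
    (ht : Tendsto t l (𝓝 t₀)) :
    Tendsto (fun p => InformationTheory.klFun (1 + p * t p) / p ^ 2) l (𝓝 (t₀ ^ 2 / 2)) := by
  have hp : Tendsto (fun p : ℝ => p) l (𝓝 0) := hl.trans nhdsWithin_le_nhds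
  have hpos : ∀ᶠ p in l, 0 < p := hl self_mem_nhdsWithin
  have hs : Tendsto (fun p => |p * t p|) l (𝓝 0) := by
    simpa using (hp.mul ht).abs
  have h2 : Tendsto (fun p => t p ^ 2 / 2) l (𝓝 (t₀ ^ 2 / 2)) := (ht.pow 2).div_const 2
  have h3 : Tendsto (fun p => 4 * p * |t p| ^ 3) l (𝓝 0) := by
    simpa using (hp.const_mul 4).mul (ht.abs.pow 3)
  have h4 : Tendsto (fun p => InformationTheory.klFun (1 + p * t p) / p ^ 2 - t p ^ 2 / 2) l
      (𝓝 0) := by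
    refine squeeze_zero_norm' ?_ h3
    filter_upwards [hpos, hs.eventually (eventually_le_nhds (by norm_num : (0 : ℝ) < 1 / 2))]
      with p hp0 hps
    have h5 := abs_klFun_one_add_sub_le hps
    have h6 : InformationTheory.klFun (1 + p * t p) / p ^ 2 - t p ^ 2 / 2
        = (InformationTheory.klFun (1 + p * t p) - (p * t p) ^ 2 / 2) / p ^ 2 := by
      field_simp
    rw [Real.norm_eq_abs, h6, abs_div, abs_pow, abs_of_pos hp0, div_le_iff₀ (by positivity)]
    refine h5.trans_eq ?_
    rw [abs_mul, abs_of_pos hp0]; ring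
  simpa using h4.add h2

lemma tendsto_sum_klFun_div {l : Filter ℝ} (hl : l ≤ 𝓝[>] 0)
    {f : ℝ → (ι → ℝ) × (ι → ℝ)} {a b : ι → ℝ} (hf : Tendsto f l (𝓝 (a, b)))
    (hpos : ∀ x, 0 < b x) :
    Tendsto (fun p => (∑ x, (f p).2 x * InformationTheory.klFun
      (1 + p * ((f p).1 x / (f p).2 x - 1))) / p ^ 2) l (𝓝 (chiSum a b / 2)) := by
  simp only [chiSum, Finset.sum_div]
  refine tendsto_finsetSum _ fun x _ => ?_
  have h1 : Tendsto (fun p => (f p).1 x) l (𝓝 (a x)) :=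
    (((continuous_apply x).comp continuous_fst).tendsto (a, b)).comp hf
  have h2 : Tendsto (fun p => (f p).2 x) l (𝓝 (b x)) :=
    (((continuous_apply x).comp continuous_snd).tendsto (a, b)).comp hf
  have h3 := h2.mul (tendsto_klFun_one_add_div hl ((h1.div h2 (hpos x).ne').sub_const 1))
  simpa only [mul_div_assoc, Pi.div_apply] using h3

/-- A pair satisfying all the dual bounds has divergence at most `c`. -/
lemma klSum_le_of_forall_dual {a b : ι → ℝ} (ha : a ∈ stdSimplex ℝ ι) (hb : b ∈ stdSimplex ℝ ι)
    {c : ℝ} (h : ∀ g : ι → ℝ, (∀ x, 0 < g x) →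
      ∑ x, (a x * Real.log (g x) - g x * b x + a x) ≤ c) :
    (∀ x, b x = 0 → a x = 0) ∧ klSum a b ≤ c := by
  classical
  have hac : ∀ x, b x = 0 → a x = 0 := by
    intro x₀ hx₀
    by_contra hne
    have hax : 0 < a x₀ := lt_of_le_of_ne (ha.1 x₀) (Ne.symm hne)
    have h1 : ∀ T : ℝ, a x₀ * T ≤ c := by
      intro T
      -- With weight `exp T` at a point where `b` vanishes and `1` elsewhere, the dual bound reads
      -- `a x₀ * T ≤ c` for every `T`, which is absurd.
      have h2 := h (fun x => if x = x₀ then Real.exp T else 1)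
        (fun x => by split_ifs <;> positivity)
      have h3 : ∑ x, (a x * Real.log (if x = x₀ then Real.exp T else 1)
          - (if x = x₀ then Real.exp T else 1) * b x + a x) = a x₀ * T := by
        have : ∀ x, (a x * Real.log (if x = x₀ then Real.exp T else 1)
          - (if x = x₀ then Real.exp T else 1) * b x + a x)
            = (if x = x₀ then a x₀ * T else 0) + (a x - b x) := by
          intro x
          split_ifs with hx
          · subst hx; rw [Real.log_exp, hx₀]; ring
          · simp; ring
        rw [Finset.sum_congr rfl fun x _ => this x, Finset.sum_add_distrib,
          Finset.sum_sub_distrib, ha.2, hb.2]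
        simp
      exact h3 ▸ h2
    have := h1 ((c + 1) / a x₀)
    rw [mul_div_cancel₀ _ hne] at this
    linarith
  refine ⟨hac, le_of_forall_pos_le_add fun η hη => ?_⟩
  -- The optimal `g` is `a / b`. It must be positive, so `η` is used where `a` vanishes, at a total
  -- cost of at most `η`.
  have h2 := h (fun x => if a x = 0 then η else a x / b x) (fun x => by
    split_ifs with hx
    · exact hη
    · exact div_pos (lt_of_le_of_ne (ha.1 x) (Ne.symm hx))
        (lt_of_le_of_ne (hb.1 x) fun h' => hx (hac x h'.symm)))
  have h3 : klSum a b - η = ∑ x, (a x * Real.log (a x / b x) - η * b x) := by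
    rw [Finset.sum_sub_distrib, ← Finset.mul_sum, hb.2, mul_one]; rfl
  have h4 : klSum a b - η ≤ c := by
    rw [h3]
    refine (Finset.sum_le_sum fun x _ => ?_).trans h2
    split_ifs with hx
    · simp [hx]
    · have hbx : b x ≠ 0 := fun h' => hx (hac x h')
      have : 0 ≤ η * b x := mul_nonneg hη.le (hb.1 x)
      rw [div_mul_cancel₀ _ hbx]
      linarith
  linarith

variable {A B : Set (ι → ℝ)} {a b : ι → ℝ} {f : ℝ → (ι → ℝ) × (ι → ℝ)}

/-- As `p → 0`, the minimizers of the information converge to the minimizer of the divergence. -/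
lemma tendsto_minimizer (hA : IsCompact A) (hB : IsCompact B) (hA' : A ⊆ stdSimplex ℝ ι)
    (hB' : B ⊆ stdSimplex ℝ ι) (ha : a ∈ A) (hb : b ∈ B) (hpos : ∀ x, 0 < b x)
    (huniq : ∀ a' ∈ A, ∀ b' ∈ B, (∀ x, b' x = 0 → a' x = 0) → klSum a' b' ≤ klSum a b →
      a' = a ∧ b' = b)
    (hf : ∀ p ∈ Set.Ioo (0 : ℝ) 1, f p ∈ A ×ˢ B)
    (hfmin : ∀ p ∈ Set.Ioo (0 : ℝ) 1, ∀ q ∈ A ×ˢ B, jsInfo p (f p).1 (f p).2 ≤ jsInfo p q.1 q.2) :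
    Tendsto f (𝓝[>] 0) (𝓝 (a, b)) := by
  have hI : ∀ᶠ p : ℝ in 𝓝[>] 0, p ∈ Set.Ioo (0 : ℝ) 1 := Ioo_mem_nhdsGT one_pos
  refine (hA.prod hB).tendsto_nhds_of_unique_mapClusterPt (hI.mono hf) ?_
  rintro ⟨a', b'⟩ ⟨ha', hb'⟩ hcl
  obtain ⟨U, hU, hlim⟩ := mapClusterPt_iff_ultrafilter.1 hcl
  have hIU : ∀ᶠ p : ℝ in U, p ∈ Set.Ioo (0 : ℝ) 1 := hU hI
  have hp : Tendsto (fun p : ℝ => p) U (𝓝 0) := hU.trans nhdsWithin_le_nhds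
  -- A cluster point might have zeros in its second component, where `klSum` is not continuous.
  -- Hence only the dual bounds are passed to the limit, after comparing the minimizer with `(a, b)`
  -- and cancelling `p`.
  have hdual : ∀ g : ι → ℝ, (∀ x, 0 < g x) →
      ∑ x, (a' x * Real.log (g x) - g x * b' x + a' x) ≤ klSum a b := by
    intro g hg
    have h1 : Tendsto (fun p => ∑ x, ((f p).1 x * Real.log (g x)
        - g x * (p * (f p).1 x + (1 - p) * (f p).2 x) + (f p).1 x)) U
        (𝓝 (∑ x, (a' x * Real.log (g x) - g x * b' x + a' x))) := by
      refine tendsto_finsetSum _ fun x _ => ?_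
      have h1 : Tendsto (fun p => (f p).1 x) U (𝓝 (a' x)) :=
        (((continuous_apply x).comp continuous_fst).tendsto (a', b')).comp hlim
      have h2 : Tendsto (fun p => (f p).2 x) U (𝓝 (b' x)) :=
        (((continuous_apply x).comp continuous_snd).tendsto (a', b')).comp hlim
      have h3 := ((h1.mul_const (Real.log (g x))).sub
        (((hp.mul h1).add ((hp.const_sub 1).mul h2)).const_mul (g x))).add h1
      simpa using h3
    refine le_of_tendsto h1 ?_
    filter_upwards [hIU] with p hpI
    have h2 := le_jsInfo hpI (hA' (hf p hpI).1) (hB' (hf p hpI).2) hg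
    have h3 := h2.trans ((hfmin p hpI (a, b) ⟨ha, hb⟩).trans
      (jsInfo_le hpI (hA' ha) (hB' hb) hpos))
    exact le_of_mul_le_mul_left h3 hpI.1
  obtain ⟨h1, h2⟩ := klSum_le_of_forall_dual (hA' ha') (hB' hb') hdual
  obtain ⟨rfl, rfl⟩ := huniq a' ha' b' hb' h1 h2
  rfl

/-- The remainder divided by `p` lies between two expressions `χ²/2 - KL(m‖b) / p²`: one taken at
the minimizers, using that their divergence is at least the optimal one, and one at the fixed
optimal pair, using minimality. Both tend to zero. -/
theorem isLittleO_jsInfo_minimizer (hA : IsCompact A) (hB : IsCompact B) (hA' : A ⊆ stdSimplex ℝ ι)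
    (hB' : B ⊆ stdSimplex ℝ ι) (ha : a ∈ A) (hb : b ∈ B) (hpos : ∀ x, 0 < b x)
    (hmin : ∀ a' ∈ A, ∀ b' ∈ B, (∀ x, b' x = 0 → a' x = 0) → klSum a b ≤ klSum a' b')
    (huniq : ∀ a' ∈ A, ∀ b' ∈ B, (∀ x, b' x = 0 → a' x = 0) → klSum a' b' ≤ klSum a b →
      a' = a ∧ b' = b)
    (hf : ∀ p ∈ Set.Ioo (0 : ℝ) 1, f p ∈ A ×ˢ B)
    (hfmin : ∀ p ∈ Set.Ioo (0 : ℝ) 1, ∀ q ∈ A ×ˢ B, jsInfo p (f p).1 (f p).2 ≤ jsInfo p q.1 q.2) :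
    (fun p => jsInfo p (f p).1 (f p).2 / p - klSum a b + chiSum a b / 2 * p)
      =o[𝓝[>] 0] fun p : ℝ => p := by
  have hI : ∀ᶠ p : ℝ in 𝓝[>] 0, p ∈ Set.Ioo (0 : ℝ) 1 := Ioo_mem_nhdsGT one_pos
  have hlim := tendsto_minimizer hA hB hA' hB' ha hb hpos huniq hf hfmin
  have hpos' : ∀ᶠ p in 𝓝[>] 0, ∀ x, 0 < (f p).2 x := by
    rw [eventually_all]
    intro x
    exact ((((continuous_apply x).comp continuous_snd).tendsto (a, b)).comp hlim).eventually
      (lt_mem_nhds (hpos x))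
  have hlow := (tendsto_sum_klFun_div le_rfl hlim hpos).const_sub (chiSum a b / 2)
  have hupp := (tendsto_sum_klFun_div (f := fun _ => (a, b)) le_rfl tendsto_const_nhds
    hpos).const_sub (chiSum a b / 2)
  rw [sub_self] at hlow hupp
  rw [isLittleO_iff_tendsto' (hI.mono fun p hp h => absurd h hp.1.ne')]
  refine tendsto_of_tendsto_of_tendsto_of_le_of_le' hlow hupp ?_ ?_
  · filter_upwards [hI, hpos'] with p hp hfp
    have h1 := jsInfo_eq hp (hA' (hf p hp).1) (hB' (hf p hp).2) hfp
    have h2 := hmin _ (hf p hp).1 _ (hf p hp).2 fun x hx => absurd hx (hfp x).ne'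
    have hp0 := hp.1
    rw [h1, le_div_iff₀ hp0, sub_mul, sub_div, mul_div_cancel_left₀ _ hp0.ne', div_mul_eq_mul_div]
    have h3 := mul_le_mul_of_nonneg_left h2 hp0.le
    field_simp
    linarith
  · filter_upwards [hI] with p hp
    have h1 := jsInfo_eq hp (hA' ha) (hB' hb) hpos
    have h2 := hfmin p hp (a, b) ⟨ha, hb⟩
    rw [h1] at h2
    have hp0 := hp.1
    rw [div_le_iff₀ hp0, sub_mul, div_mul_eq_mul_div]
    have h3 := div_le_div_of_nonneg_right h2 hp0.le
    rw [sub_div, mul_div_cancel_left₀ _ hp0.ne'] at h3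
    field_simp at h3 ⊢
    linarith

end WeightFunctions

/-! ### Divergences of measures, and their reduction to sums over a finite set. -/

section FiniteSupport

variable {α : Type*} [MeasurableSpace α]

/-- The Donsker-Varadhan lower bound on the divergence, in its additive form. -/
lemma ofReal_integral_sub_le_klDiv (P Q : Measure α) [IsProbabilityMeasure P]
    [IsProbabilityMeasure Q] {L : α → ℝ} (hL : Measurable L) {C : ℝ} (hC : ∀ z, |L z| ≤ C) :
    ENNReal.ofReal (∫ z, L z ∂P - ∫ z, Real.exp (L z) ∂Q + 1)
      ≤ InformationTheory.klDiv P Q := by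
  rw [InformationTheory.klDiv_eq_integral_klFun]
  split_ifs with h
  swap
  · exact le_top
  obtain ⟨hac, hint⟩ := h
  refine ENNReal.ofReal_le_ofReal ?_
  have hLP : Integrable L P :=
    Integrable.of_bound hL.aestronglyMeasurable C (ae_of_all _ hC)
  have hexp : Integrable (fun z => Real.exp (L z)) Q := by
    refine Integrable.of_bound hL.exp.aestronglyMeasurable (Real.exp C) (ae_of_all _ fun z => ?_)
    rw [Real.norm_eq_abs, Real.abs_exp]
    exact Real.exp_le_exp.2 ((le_abs_self _).trans (hC z))
  have hfL : Integrable (fun z => (P.rnDeriv Q z).toReal • L z) Q :=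
    (integrable_rnDeriv_smul_iff hac).2 hLP
  have hkl := (InformationTheory.integrable_klFun_rnDeriv_iff hac).2 hint
  have h1 : ∫ z, L z ∂P - ∫ z, Real.exp (L z) ∂Q + 1
      = ∫ z, ((P.rnDeriv Q z).toReal • L z - Real.exp (L z) + 1) ∂Q := by
    rw [integral_add (f := fun z => (P.rnDeriv Q z).toReal • L z - Real.exp (L z))
      (hfL.sub hexp) (integrable_const _), integral_sub hfL hexp,
      integral_rnDeriv_smul hac]
    simp
  rw [h1]
  refine integral_mono ((hfL.sub hexp).add (integrable_const _)) hkl fun z => ?_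
  -- Pointwise, the density `ρ` satisfies `ρ L - exp L + 1 ≤ klFun ρ`.
  have h2 := mul_log_sub_mul_log_ge (a := (P.rnDeriv Q z).toReal) (m := 1) (g := Real.exp (L z))
    ENNReal.toReal_nonneg zero_le_one (Real.exp_pos _) (fun h => absurd h one_ne_zero)
  rw [Real.log_exp, Real.log_one] at h2
  simp only [smul_eq_mul, InformationTheory.klFun_apply]
  linarith

lemma absolutelyContinuous_of_singleton {μ ν : Measure α} {S : Finset α}
    (hμ : μ (S : Set α)ᶜ = 0) (h : ∀ x ∈ S, ν {x} = 0 → μ {x} = 0) : μ ≪ ν := by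
  refine Measure.AbsolutelyContinuous.mk fun s _ hs => ?_
  have h1 : μ (s ∩ S) = 0 := by
    have : s ∩ (S : Set α) = ⋃ x ∈ {x ∈ (S : Set α) | x ∈ s}, {x} := by
      ext y; simp [and_comm]
    rw [this, measure_biUnion_null_iff
      ((S.finite_toSet.subset (Set.sep_subset _ _)).countable)]
    exact fun x hx => h x hx.1 (measure_mono_null (Set.singleton_subset_iff.2 hx.2) hs)
  exact measure_mono_null (fun y hy => by
    by_cases hyS : y ∈ (S : Set α)
    · exact Or.inl ⟨hy, hyS⟩
    · exact Or.inr hyS) (measure_union_null h1 hμ)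

variable [MeasurableSingletonClass α]

lemma rnDeriv_mul_singleton {μ ν : Measure α} [SigmaFinite μ] [SigmaFinite ν] (h : μ ≪ ν)
    (x : α) : μ.rnDeriv ν x * ν {x} = μ {x} := by
  conv_rhs => rw [← Measure.withDensity_rnDeriv_eq μ ν h]
  rw [withDensity_apply _ (measurableSet_singleton x), lintegral_singleton]

lemma lintegral_eq_sum_of_compl_null {ν : Measure α} {S : Finset α} (hS : ν (S : Set α)ᶜ = 0)
    (φ : α → ℝ≥0∞) : ∫⁻ x, φ x ∂ν = ∑ x : S, φ x * ν {x.1} := by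
  rw [Finset.sum_coe_sort S fun x => φ x * ν {x}, ← lintegral_finset,
    Measure.restrict_eq_self_of_ae_mem (s := (S : Set α))]
  exact hS

lemma lintegral_rnDeriv_eq_sum {μ ν : Measure α} [IsFiniteMeasure μ] [IsFiniteMeasure ν]
    {S : Finset α} (hS : ν (S : Set α)ᶜ = 0) (h : μ ≪ ν) (φ : ℝ → ℝ)
    (hφ : ∀ x, 0 ≤ x → 0 ≤ φ x) :
    ∫⁻ x, ENNReal.ofReal (φ (μ.rnDeriv ν x).toReal) ∂ν
      = ENNReal.ofReal (∑ x : S, ν.real {x.1} * φ (μ.real {x.1} / ν.real {x.1})) := by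
  rw [lintegral_eq_sum_of_compl_null hS, ENNReal.ofReal_sum_of_nonneg]
  · refine Finset.sum_congr rfl fun x _ => ?_
    rw [ENNReal.ofReal_mul measureReal_nonneg, ofReal_measureReal, mul_comm]
    by_cases hx : ν {x.1} = 0
    · simp [hx]
    · have hx' : ν.real {x.1} ≠ 0 := by
        rw [measureReal_def]; exact ENNReal.toReal_ne_zero.2 ⟨hx, measure_ne_top _ _⟩
      congr 3
      rw [eq_div_iff hx', measureReal_def, measureReal_def, ← ENNReal.toReal_mul,
        rnDeriv_mul_singleton h]
  · intro x _
    exact mul_nonneg measureReal_nonneg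
      (hφ _ (div_nonneg measureReal_nonneg measureReal_nonneg))

/-- The masses of the points of a finite set. -/
noncomputable def weights (S : Finset α) (μ : Measure α) (x : S) : ℝ := μ.real {x.1}

lemma weights_mem_stdSimplex {S : Finset α} (μ : Measure α) [IsProbabilityMeasure μ]
    (hS : μ (S : Set α)ᶜ = 0) : weights S μ ∈ stdSimplex ℝ S := by
  refine ⟨fun x => measureReal_nonneg, ?_⟩
  have h1 := lintegral_eq_sum_of_compl_null hS (fun _ => 1)
  simp only [lintegral_const, measure_univ, one_mul] at h1
  have h2 := congrArg ENNReal.toReal h1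
  rw [ENNReal.toReal_sum (fun _ _ => measure_ne_top _ _)] at h2
  simpa [weights, measureReal_def] using h2.symm

/-- The integrand `klFun` is nonnegative, so the integral becomes a finite sum with no integrability
condition. Its extra linear terms cancel because both masses are one. -/
lemma klDiv_eq_klSum {μ ν : Measure α} [IsProbabilityMeasure μ] [IsProbabilityMeasure ν]
    {S : Finset α} (hμ : μ (S : Set α)ᶜ = 0) (hν : ν (S : Set α)ᶜ = 0)
    (h : μ ≪ ν) :
    InformationTheory.klDiv μ ν = ENNReal.ofReal (klSum (weights S μ) (weights S ν)) := by
  rw [InformationTheory.klDiv_eq_lintegral_klFun_of_ac h,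
    lintegral_rnDeriv_eq_sum hν h _ fun _ => InformationTheory.klFun_nonneg]
  congr 1
  have h1 := (weights_mem_stdSimplex μ hμ).2
  have h2 := (weights_mem_stdSimplex ν hν).2
  have h3 : klSum (weights S μ) (weights S ν)
      = ∑ x, (weights S μ x * Real.log (weights S μ x / weights S ν x)
        + weights S ν x - weights S μ x) := by
    rw [Finset.sum_sub_distrib, Finset.sum_add_distrib, h1, h2]; simp [klSum]
  rw [h3]
  refine Finset.sum_congr rfl fun x _ => ?_
  change weights S ν x * InformationTheory.klFun (weights S μ x / weights S ν x) = _
  by_cases hx : weights S ν x = 0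
  · have hx' : weights S μ x = 0 := by
      have : ν {x.1} = 0 := (measureReal_eq_zero_iff (measure_ne_top _ _)).1 hx
      simp [weights, measureReal_def, h this]
    simp [hx, hx']
  · rw [InformationTheory.klFun_apply]; field_simp

lemma chiSqDiv_eq_chiSum {μ ν : Measure α} [IsProbabilityMeasure μ] [IsProbabilityMeasure ν]
    {S : Finset α} (hν : ν (S : Set α)ᶜ = 0) (h : μ ≪ ν) :
    chiSqDiv μ ν = ENNReal.ofReal (chiSum (weights S μ) (weights S ν)) := by
  rw [chiSqDiv, if_pos h, lintegral_rnDeriv_eq_sum hν h (fun t => (t - 1) ^ 2)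
    fun _ _ => sq_nonneg _]
  rfl

end FiniteSupport

/-! ### Measures built from weight vectors. -/

section WeightMeasure

variable {ι : Type*} [Fintype ι] [MeasurableSpace ι]

/-- The measure with prescribed masses of the points of a finite type. -/
noncomputable def weightMeasure (a : ι → ℝ) : Measure ι :=
  ∑ x, ENNReal.ofReal (a x) • Measure.dirac x

lemma isProbabilityMeasure_weightMeasure {a : ι → ℝ} (ha : a ∈ stdSimplex ℝ ι) :
    IsProbabilityMeasure (weightMeasure a) := by
  constructor
  simp only [weightMeasure, Measure.finsetSum_apply, Measure.smul_apply, measure_univ, smul_eq_mul,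
    mul_one]
  rw [← ENNReal.ofReal_sum_of_nonneg fun x _ => ha.1 x, ha.2, ENNReal.ofReal_one]

variable [MeasurableSingletonClass ι]

lemma weightMeasure_singleton (a : ι → ℝ) (x : ι) :
    weightMeasure a {x} = ENNReal.ofReal (a x) := by
  classical
  simp [weightMeasure, Measure.finsetSum_apply, Set.indicator_apply, Finset.sum_ite_eq']

end WeightMeasure

section WeightMeasureMap

variable {α : Type*} [MeasurableSpace α] [MeasurableSingletonClass α] {S : Finset α}

lemma map_weightMeasure_compl (a : S → ℝ) :
    (weightMeasure a).map Subtype.val (S : Set α)ᶜ = 0 := by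
  rw [Measure.map_apply measurable_subtype_coe S.measurableSet.compl]
  have : (Subtype.val ⁻¹' (S : Set α)ᶜ : Set S) = ∅ := by ext; simp
  simp [this]

lemma map_weightMeasure_singleton (a : S → ℝ) (x : S) :
    (weightMeasure a).map Subtype.val {x.1} = ENNReal.ofReal (a x) := by
  rw [Measure.map_apply measurable_subtype_coe (measurableSet_singleton _)]
  have : (Subtype.val ⁻¹' {x.1} : Set S) = {x} := Set.ext fun y => Subtype.coe_inj
  rw [this, weightMeasure_singleton]

lemma weights_map_weightMeasure {a : S → ℝ} (ha : ∀ x, 0 ≤ a x) :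
    weights S ((weightMeasure a).map Subtype.val) = a := by
  ext x
  rw [weights, measureReal_def, map_weightMeasure_singleton, ENNReal.toReal_ofReal (ha x)]

lemma lintegral_map_weightMeasure (a : S → ℝ) (d : α → ℝ≥0∞) :
    ∫⁻ x, d x ∂(weightMeasure a).map Subtype.val = ∑ x : S, d x * ENNReal.ofReal (a x) := by
  rw [lintegral_eq_sum_of_compl_null (map_weightMeasure_compl a)]
  simp only [map_weightMeasure_singleton]

end WeightMeasureMap

/-! ### Compactness of the feasible weights. -/

section FeasibleWeights

variable {ι : Type*} [Fintype ι]

/-- The weight functions of total mass one and of expected cost at most `ε`. -/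
def feasibleWeights (d : ι → ℝ≥0∞) (ε : ℝ≥0∞) : Set (ι → ℝ) :=
  {a ∈ stdSimplex ℝ ι | ∑ x, d x * ENNReal.ofReal (a x) ≤ ε}

/-- The cost may be infinite, and multiplication by `∞` is discontinuous at `0`. As a supremum of
the continuous costs truncated at `n`, the expected cost is still lower semicontinuous, which
suffices. -/
lemma isClosed_feasibleWeights (d : ι → ℝ≥0∞) (ε : ℝ≥0∞) : IsClosed (feasibleWeights d ε) := by
  refine (isClosed_stdSimplex ℝ ι).inter ?_
  have hlsc : LowerSemicontinuous fun a : ι → ℝ => ∑ x, d x * ENNReal.ofReal (a x) := by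
    refine lowerSemicontinuous_sum fun x _ => ?_
    have h1 : (fun a : ι → ℝ => d x * ENNReal.ofReal (a x))
        = fun a => ⨆ n : ℕ, min (d x) n * ENNReal.ofReal (a x) := by
      ext a
      rw [← ENNReal.iSup_mul]
      congr 1
      refine le_antisymm ?_ (iSup_le fun n => min_le_left _ _)
      rcases eq_or_ne (d x) ∞ with h | h
      · simp [h, ENNReal.iSup_natCast]
      · obtain ⟨n, hn⟩ := ENNReal.exists_nat_gt h
        exact le_iSup_of_le n (le_min le_rfl hn.le)
    rw [h1]
    refine lowerSemicontinuous_iSup fun n => Continuous.lowerSemicontinuous ?_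
    exact (ENNReal.continuous_const_mul ((min_le_right _ _).trans_lt
      (ENNReal.natCast_lt_top n)).ne).comp
      (ENNReal.continuous_ofReal.comp (continuous_apply x))
  exact hlsc.isClosed_preimage ε

lemma isCompact_feasibleWeights (d : ι → ℝ≥0∞) (ε : ℝ≥0∞) : IsCompact (feasibleWeights d ε) :=
  (isCompact_stdSimplex ℝ ι).of_isClosed_subset (isClosed_feasibleWeights d ε) fun _ h => h.1

end FeasibleWeights

/-! ### The binomial mode and the comparison with independent keys. -/

section BinomialMode

/-- The Poisson weights `n ^ k / k!` of mean `n` are largest at `k = n`. -/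
lemma factorial_mul_pow_le (n k : ℕ) : n.factorial * n ^ k ≤ k.factorial * n ^ n := by
  rcases le_total n k with h | h
  · calc n.factorial * n ^ k = n.factorial * n ^ (k - n) * n ^ n := by
          rw [mul_assoc, ← pow_add, Nat.sub_add_cancel h]
      _ ≤ _ := Nat.mul_le_mul_right _ (Nat.factorial_mul_pow_sub_le_factorial h)
  · have h1 : n.factorial = k.factorial * n.descFactorial (n - k) := by
      rw [← Nat.factorial_mul_descFactorial (Nat.sub_le n k), Nat.sub_sub_self h]
    calc n.factorial * n ^ k ≤ k.factorial * n ^ (n - k) * n ^ k := by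
          rw [h1]; gcongr; exact Nat.descFactorial_le_pow _ _
      _ = _ := by rw [mul_assoc, ← pow_add, Nat.sub_add_cancel h]

/-- Up to a common factor a binomial weight is a product of two Poisson weights, of means `n` and
`m`, and each factor is largest at its mean. -/
lemma choose_mul_pow_le (n m k l : ℕ) (h : k + l = n + m) :
    (n + m).choose k * (n ^ k * m ^ l) ≤ (n + m).choose n * (n ^ n * m ^ m) := by
  have h1 := Nat.mul_le_mul (factorial_mul_pow_le n k) (factorial_mul_pow_le m l)
  have h2 : (n + m).choose k * k.factorial * l.factorial = (n + m).factorial := by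
    rw [← h, Nat.choose_symm_add]; exact Nat.add_choose_mul_factorial_mul_factorial k l
  have h3 := Nat.add_choose_mul_factorial_mul_factorial n m
  rw [← Nat.choose_symm_add] at h3
  have hpos : 0 < k.factorial * l.factorial * (n.factorial * m.factorial) := by positivity
  refine Nat.le_of_mul_le_mul_left ?_ hpos
  calc k.factorial * l.factorial * (n.factorial * m.factorial)
        * ((n + m).choose k * (n ^ k * m ^ l))
      = ((n + m).choose k * k.factorial * l.factorial)
        * (n.factorial * n ^ k * (m.factorial * m ^ l)) := by ring
    _ ≤ ((n + m).choose n * n.factorial * m.factorial)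
        * (k.factorial * n ^ n * (l.factorial * m ^ m)) := by
        rw [h2, h3]; exact Nat.mul_le_mul_left _ h1
    _ = _ := by ring

/-- The mode of a binomial distribution with integral mean has probability at least
`1 / (u + 1)`. -/
lemma one_le_mul_binomial_mode {u n : ℕ} (hu : 0 < u) (hn : n ≤ u) {p : ℝ}
    (hp : p = (n : ℝ) / u) :
    1 ≤ (u + 1 : ℝ) * (u.choose n * (p ^ n * (1 - p) ^ (u - n))) := by
  obtain ⟨m, rfl⟩ := Nat.exists_eq_add_of_le hn
  have hu' : (0 : ℝ) < (n + m : ℕ) := by exact_mod_cast hu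
  have hq : 1 - p = (m : ℝ) / (n + m : ℕ) := by
    rw [hp]; field_simp; push_cast; ring
  have hterm : ∀ k ∈ Finset.range (n + m + 1),
      p ^ k * (1 - p) ^ (n + m - k) * ((n + m).choose k : ℝ)
        ≤ (n + m).choose n * (p ^ n * (1 - p) ^ m) := by
    intro k hk
    have hk' : k + (n + m - k) = n + m := by
      have := Finset.mem_range.1 hk; omega
    have h1 : (((n + m).choose k * (n ^ k * m ^ (n + m - k)) : ℕ) : ℝ)
        ≤ (((n + m).choose n * (n ^ n * m ^ m) : ℕ) : ℝ) :=
      Nat.cast_le.2 (choose_mul_pow_le n m k _ hk')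
    have h2 : ∀ i j : ℕ, i + j = n + m →
        p ^ i * (1 - p) ^ j = (n : ℝ) ^ i * (m : ℝ) ^ j / ((n + m : ℕ) : ℝ) ^ (n + m) := by
      intro i j hij
      rw [hq, hp, div_pow, div_pow, div_mul_div_comm, ← pow_add, hij]
    rw [h2 _ _ hk', h2 _ _ rfl, mul_comm, ← mul_div_assoc, ← mul_div_assoc]
    push_cast at h1 ⊢
    gcongr
  have hsum := add_pow p (1 - p) (n + m)
  rw [add_sub_cancel, one_pow] at hsum
  rw [Nat.add_sub_cancel_left]
  refine hsum.le.trans ((Finset.sum_le_card_nsmul _ _ _ hterm).trans_eq ?_)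
  rw [Finset.card_range, nsmul_eq_mul]
  push_cast
  ring

lemma card_keySet (u n : ℕ) : Fintype.card (KeySet u n) = u.choose n := by
  simp [KeySet, Fintype.card_finset_len]

lemma prod_ite_mem_const {u : ℕ} (K : Finset (Fin u)) (p q : ℝ) :
    ∏ i, (if i ∈ K then p else q) = p ^ K.card * q ^ (u - K.card) := by
  rw [Finset.prod_ite, Finset.prod_const, Finset.prod_const, Finset.filter_mem_eq_inter,
    Finset.univ_inter, Finset.filter_not, Finset.filter_mem_eq_inter, Finset.univ_inter,
    ← Finset.compl_eq_univ_sdiff, Finset.card_compl, Fintype.card_fin]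

/-- Averages of products over key sets are controlled by those over independent keys. -/
lemma sum_keySet_prod_le {u n : ℕ} (hn : 0 < n) (hnu : n < u) {p : ℝ}
    (hp : p = (n : ℝ) / u) {h₁ h₀ : Fin u → ℝ} (hh₁ : ∀ i, 0 ≤ h₁ i) (hh₀ : ∀ i, 0 ≤ h₀ i)
    (h : ∀ i, p * h₁ i + (1 - p) * h₀ i ≤ 1) :
    ∑ K : KeySet u n, ∏ i, (if i ∈ K.1 then h₁ i else h₀ i) ≤ (u + 1) * u.choose n := by
  have hu : (0 : ℝ) < u := by exact_mod_cast hn.trans hnu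
  have hp0 : 0 < p := by rw [hp]; positivity
  have hp1 : 0 < 1 - p := by
    rw [hp, sub_pos, div_lt_one hu]; exact_mod_cast hnu
  have hc : 0 < p ^ n * (1 - p) ^ (u - n) := by positivity
  -- Independent keys give every set of size `n` the same probability `p ^ n * (1 - p) ^ (u - n)`.
  -- Adding the sets of other sizes only increases the sum, which then factorizes over the universe.
  have h1 : (∑ K : KeySet u n, ∏ i, (if i ∈ K.1 then h₁ i else h₀ i))
      * (p ^ n * (1 - p) ^ (u - n)) ≤ 1 := by
    calc (∑ K : KeySet u n, ∏ i, (if i ∈ K.1 then h₁ i else h₀ i)) * (p ^ n * (1 - p) ^ (u - n))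
        = ∑ K : KeySet u n, ∏ i, (if i ∈ K.1 then p * h₁ i else (1 - p) * h₀ i) := by
          rw [Finset.sum_mul]
          refine Finset.sum_congr rfl fun K _ => ?_
          have h2 := prod_ite_mem_const K.1 p (1 - p)
          rw [K.2] at h2
          rw [← h2, ← Finset.prod_mul_distrib]
          refine Finset.prod_congr rfl fun i _ => ?_
          split_ifs <;> ring
      _ = ∑ K ∈ (Finset.univ : Finset (Finset (Fin u))).filter (fun K => K.card = n),
          ∏ i, (if i ∈ K then p * h₁ i else (1 - p) * h₀ i) :=
          (Finset.sum_subtype _ (by simp)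
            fun K => ∏ i, (if i ∈ K then p * h₁ i else (1 - p) * h₀ i)).symm
      _ ≤ ∑ K : Finset (Fin u), ∏ i, (if i ∈ K then p * h₁ i else (1 - p) * h₀ i) := by
          refine Finset.sum_le_sum_of_subset_of_nonneg (Finset.filter_subset _ _)
            fun K _ _ => Finset.prod_nonneg fun i _ => ?_
          split_ifs
          · exact mul_nonneg hp0.le (hh₁ i)
          · exact mul_nonneg hp1.le (hh₀ i)
      _ = ∏ i, (p * h₁ i + (1 - p) * h₀ i) := by
          rw [Finset.prod_add, Finset.powerset_univ]
          refine Finset.sum_congr rfl fun K _ => ?_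
          rw [Finset.prod_ite, Finset.filter_mem_eq_inter, Finset.univ_inter, Finset.filter_not,
            Finset.filter_mem_eq_inter, Finset.univ_inter]
      _ ≤ 1 := Finset.prod_le_one (fun i _ => add_nonneg (mul_nonneg hp0.le (hh₁ i))
          (mul_nonneg hp1.le (hh₀ i))) fun i _ => h i
  refine le_of_mul_le_mul_right (h1.trans ?_) hc
  exact (one_le_mul_binomial_mode (hn.trans hnu) hnu.le hp).trans_eq (by ring)

end BinomialMode

/-! ### Output laws of testers and the lower bound on the budget. -/

namespace MembershipTester

variable {u n : ℕ} (M : MembershipTester u n)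

lemma exists_keySet_mem (hn : 0 < n) (hnu : n < u) : ∃ (K : KeySet u n) (i : Fin u), i ∈ K.1 := by
  obtain ⟨K, -, hK⟩ := Finset.exists_subset_card_eq (s := (Finset.univ : Finset (Fin u)))
    (n := n) (by simpa using hnu.le)
  obtain ⟨i, hi⟩ := Finset.card_pos.1 (hK ▸ hn)
  exact ⟨⟨K, hK⟩, i, hi⟩

lemma exists_keySet_notMem (hnu : n < u) : ∃ (K : KeySet u n) (i : Fin u), i ∉ K.1 := by
  obtain ⟨K, -, hK⟩ := Finset.exists_subset_card_eq (s := (Finset.univ : Finset (Fin u)))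
    (n := n) (by simpa using hnu.le)
  have : ∃ i, i ∉ K := by
    by_contra! h
    have h1 : K = Finset.univ := Finset.eq_univ_iff_forall.2 h
    rw [h1, Finset.card_univ, Fintype.card_fin] at hK
    omega
  exact ⟨⟨K, hK⟩, this⟩

lemma nonempty_keySet (hnu : n < u) : Nonempty (KeySet u n) :=
  let ⟨K, _⟩ := exists_keySet_notMem hnu
  ⟨K⟩

instance (K : KeySet u n) (i : Fin u) : IsProbabilityMeasure (M.outputLaw K i) := by
  unfold outputLaw
  infer_instance

lemma outputLaw_apply (K : KeySet u n) (i : Fin u) {s : Set unitInterval} (hs : MeasurableSet s) :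
    M.outputLaw K i s = ∫⁻ z, M.query i z s ∂M.memoryLaw K :=
  Measure.bind_apply hs (M.query i).measurable.aemeasurable

variable {M}

lemma outputLaw_compl {X : Set unitInterval} (hX : MeasurableSet X) (hM : M.OutputsIn X)
    (K : KeySet u n) (i : Fin u) : M.outputLaw K i Xᶜ = 0 := by
  rw [outputLaw_apply M K i hX.compl]
  simp [hM i]

section LowerBound

variable (M) in
/-- The logarithm of the likelihood ratio that the answers `x` to all queries assign to a key set
when `r₁ x` and `r₀ x` are the likelihood ratios for a key and for a non-key. -/
noncomputable def scoreLog (S : Finset unitInterval) (r₁ r₀ : S → ℝ)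
    (q : KeySet u n × (M.Seed × M.State)) : ℝ :=
  ∑ i, ∑ x : S, (M.query i q.2).real {x.1} * Real.log (if i ∈ q.1.1 then r₁ x else r₀ x)

variable {S : Finset unitInterval} {r₁ r₀ : S → ℝ}

lemma measurable_query_real (i : Fin u) (x : unitInterval) :
    Measurable fun z => (M.query i z).real {x} :=
  ((M.query i).measurable_coe (measurableSet_singleton x)).ennreal_toReal

lemma measurable_scoreLog : Measurable (M.scoreLog S r₁ r₀) := by
  refine measurable_from_prod_countable_right fun K => ?_
  refine Finset.measurable_sum _ fun i _ => Finset.measurable_sum _ fun x _ => ?_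
  exact (measurable_query_real (M := M) i x.1).mul_const
    (Real.log (if i ∈ K.1 then r₁ x else r₀ x))

lemma abs_scoreLog_le (q : KeySet u n × (M.Seed × M.State)) :
    |M.scoreLog S r₁ r₀ q| ≤ ∑ _i : Fin u, ∑ x : S, (|Real.log (r₁ x)| + |Real.log (r₀ x)|) := by
  refine (Finset.abs_sum_le_sum_abs _ _).trans (Finset.sum_le_sum fun i _ => ?_)
  refine (Finset.abs_sum_le_sum_abs _ _).trans (Finset.sum_le_sum fun x _ => ?_)
  rw [abs_mul, abs_of_nonneg measureReal_nonneg]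
  have h1 : |Real.log (if i ∈ q.1.1 then r₁ x else r₀ x)|
      ≤ |Real.log (r₁ x)| + |Real.log (r₀ x)| := by
    split_ifs
    · exact le_add_of_nonneg_right (abs_nonneg _)
    · exact le_add_of_nonneg_left (abs_nonneg _)
  exact (mul_le_of_le_one_left (abs_nonneg _) measureReal_le_one).trans h1

/-- Jensen's inequality for `exp`, one query at a time. Averaging the logarithm over the query's
randomness keeps the score a function of key set and memory alone. -/
lemma exp_scoreLog_le (hM : M.OutputsIn S) (hr₁ : ∀ x, 0 < r₁ x) (hr₀ : ∀ x, 0 < r₀ x)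
    (K : KeySet u n) (z : M.Seed × M.State) :
    Real.exp (M.scoreLog S r₁ r₀ (K, z))
      ≤ ∏ i, (if i ∈ K.1 then ∑ x : S, (M.query i z).real {x.1} * r₁ x
          else ∑ x : S, (M.query i z).real {x.1} * r₀ x) := by
  rw [scoreLog, Real.exp_sum]
  refine Finset.prod_le_prod (fun _ _ => (Real.exp_pos _).le) fun i _ => ?_
  have hw := weights_mem_stdSimplex (S := S) (M.query i z) (hM i z)
  have h1 : ∀ r : S → ℝ, (∀ x, 0 < r x) →
      Real.exp (∑ x : S, (M.query i z).real {x.1} * Real.log (r x))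
        ≤ ∑ x : S, (M.query i z).real {x.1} * r x := by
    intro r hr
    have h2 := convexOn_exp.map_sum_le (t := Finset.univ) (w := weights S (M.query i z))
      (p := fun x => Real.log (r x)) (fun x _ => hw.1 x) hw.2 (fun x _ => Set.mem_univ _)
    simpa only [smul_eq_mul, weights, Real.exp_log (hr _)] using h2
  dsimp only
  split_ifs
  · exact h1 r₁ hr₁
  · exact h1 r₀ hr₀

lemma integral_query_real (K : KeySet u n) (i : Fin u) (x : unitInterval) :
    ∫ z, (M.query i z).real {x} ∂M.memoryLaw K = (M.outputLaw K i).real {x} := by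
  rw [measureReal_def, outputLaw_apply M K i (measurableSet_singleton x)]
  exact integral_toReal ((M.query i).measurable_coe (measurableSet_singleton x)).aemeasurable
    (ae_of_all _ fun z => measure_lt_top _ _)

lemma sum_ite_keySet (K : KeySet u n) (c d : ℝ) :
    ∑ i, (if i ∈ K.1 then c else d) = n * c + (u - n) * d := by
  have hle : n ≤ u := by
    have := Finset.card_le_univ K.1
    rwa [K.2, Fintype.card_fin] at this
  rw [Finset.sum_ite, Finset.sum_const, Finset.sum_const, Finset.filter_mem_eq_inter,
    Finset.univ_inter, Finset.filter_not, Finset.filter_mem_eq_inter, Finset.univ_inter,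
    ← Finset.compl_eq_univ_sdiff, Finset.card_compl, Fintype.card_fin, K.2, nsmul_eq_mul,
    nsmul_eq_mul, Nat.cast_sub hle]

/-- By linearity only the law of each single answer enters, so dependence between answers to
different queries is irrelevant. -/
lemma integral_scoreLog_memoryLaw (hM : M.PermutationInvariant) (K : KeySet u n) :
    ∫ z, M.scoreLog S r₁ r₀ (K, z) ∂M.memoryLaw K
      = n * ∑ x, weights S M.keyLaw x * Real.log (r₁ x)
        + (u - n) * ∑ x, weights S M.nonkeyLaw x * Real.log (r₀ x) := by
  have hint : ∀ (i : Fin u) (x : S), Integrable (fun z => (M.query i z).real {x.1}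
      * Real.log (if i ∈ K.1 then r₁ x else r₀ x)) (M.memoryLaw K) := fun i x => by
    refine Integrable.mul_const (Integrable.of_bound
      (measurable_query_real i x.1).aestronglyMeasurable 1 (ae_of_all _ fun z => ?_)) _
    rw [Real.norm_eq_abs, abs_of_nonneg measureReal_nonneg]
    exact measureReal_le_one
  unfold scoreLog
  rw [integral_finsetSum _ fun i _ => integrable_finsetSum _ fun x _ => hint i x,
    ← sum_ite_keySet K]
  refine Finset.sum_congr rfl fun i _ => ?_
  rw [integral_finsetSum _ fun x _ => hint i x]
  simp only [integral_mul_const, integral_query_real]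
  split_ifs with hi
  · rw [keyLaw_eq_outputLaw M hM K i hi]; rfl
  · rw [nonkeyLaw_eq_outputLaw M hM K i hi]; rfl

lemma integral_uniformOn_keySet (f : KeySet u n → ℝ) :
    ∫ K, f K ∂uniformOn (Set.univ : Set (KeySet u n)) = (∑ K, f K) / u.choose n := by
  rw [integral_fintype (.of_finite), Finset.sum_div]
  refine Finset.sum_congr rfl fun K _ => ?_
  rw [measureReal_def, uniformOn_univ, Measure.count_singleton, card_keySet, smul_eq_mul]
  simp [div_eq_inv_mul]

lemma isProbabilityMeasure_uniformOn_keySet (hnu : n < u) :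
    IsProbabilityMeasure (uniformOn (Set.univ : Set (KeySet u n))) :=
  have := nonempty_keySet hnu
  isProbabilityMeasure_uniformOn Set.finite_univ Set.univ_nonempty

/-- Any pair of decoders gives a lower bound on the information held in the memory. -/
lemma klDiv_jointLaw_ge_of_decoder (hn : 0 < n) (hnu : n < u) {p : ℝ} (hp : p = (n : ℝ) / u)
    (hM : M.PermutationInvariant) (hout : M.OutputsIn S) (hr₁ : ∀ x, 0 < r₁ x)
    (hr₀ : ∀ x, 0 < r₀ x) (hr : ∀ x, p * r₁ x + (1 - p) * r₀ x ≤ 1) :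
    ENNReal.ofReal (n * ∑ x, weights S M.keyLaw x * Real.log (r₁ x)
        + (u - n) * ∑ x, weights S M.nonkeyLaw x * Real.log (r₀ x) - Real.log (u + 1))
      ≤ InformationTheory.klDiv M.jointLaw (M.jointLaw.fst.prod M.jointLaw.snd) := by
  have hunif := isProbabilityMeasure_uniformOn_keySet hnu
  have hjoint : IsProbabilityMeasure M.jointLaw := by
    unfold jointLaw; infer_instance
  have hu : (0 : ℝ) < u + 1 := by positivity
  have hmeas : Measurable (M.scoreLog S r₁ r₀) := measurable_scoreLog
  set C := ∑ _i : Fin u, ∑ x : S, (|Real.log (r₁ x)| + |Real.log (r₀ x)|) with hC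
  have hexp_bound : ∀ q, ‖Real.exp (M.scoreLog S r₁ r₀ q - Real.log (u + 1))‖
      ≤ Real.exp (C + |Real.log (u + 1)|) := fun q => by
    rw [Real.norm_eq_abs, Real.abs_exp]
    refine Real.exp_le_exp.2 ((le_abs_self _).trans ((abs_sub _ _).trans ?_))
    exact add_le_add_left (abs_scoreLog_le q) _
  -- Subtracting `log (u + 1)` normalizes the exponential moment to at most `1`, which cancels the
  -- `+ 1` in the variational bound.
  refine le_trans (ENNReal.ofReal_le_ofReal ?_) (ofReal_integral_sub_le_klDiv _ _
    (L := fun q => M.scoreLog S r₁ r₀ q - Real.log (u + 1)) (hmeas.sub_const _)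
    (C := C + |Real.log (u + 1)|) fun q => (abs_sub _ _).trans
      (add_le_add_left (abs_scoreLog_le q) _))
  have hLint : Integrable (M.scoreLog S r₁ r₀) M.jointLaw :=
    Integrable.of_bound hmeas.aestronglyMeasurable C (ae_of_all _ abs_scoreLog_le)
  have h1 : ∫ q, (M.scoreLog S r₁ r₀ q - Real.log (u + 1)) ∂M.jointLaw
      = n * ∑ x, weights S M.keyLaw x * Real.log (r₁ x)
        + (u - n) * ∑ x, weights S M.nonkeyLaw x * Real.log (r₀ x) - Real.log (u + 1) := by
    rw [integral_sub hLint (integrable_const _), integral_const, probReal_univ, one_smul]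
    congr 1
    unfold jointLaw at hLint ⊢
    rw [Measure.integral_compProd hLint]
    have h2 : ∀ K, ∫ z, M.scoreLog S r₁ r₀ (K, z) ∂M.memoryKernel K = _ :=
      fun K => integral_scoreLog_memoryLaw hM K
    simp only [h2, integral_const, probReal_univ, one_smul]
  have h2 : ∫ q, Real.exp (M.scoreLog S r₁ r₀ q - Real.log (u + 1))
      ∂(M.jointLaw.fst.prod M.jointLaw.snd) ≤ 1 := by
    rw [integral_prod_symm _ (Integrable.of_bound
      (hmeas.sub_const _).exp.aestronglyMeasurable _ (ae_of_all _ hexp_bound))]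
    -- Under the product of the marginals the key set stays uniform once the memory is fixed, so the
    -- comparison with independent keys applies for each `z`.
    have h3 : ∀ z, ∫ K, Real.exp (M.scoreLog S r₁ r₀ (K, z) - Real.log (u + 1))
        ∂M.jointLaw.fst ≤ 1 := by
      intro z
      have hfst : M.jointLaw.fst = uniformOn (Set.univ : Set (KeySet u n)) :=
        Measure.fst_compProd _ _
      have hch : (0 : ℝ) < u.choose n := by exact_mod_cast Nat.choose_pos hnu.le
      rw [hfst, integral_uniformOn_keySet, div_le_one hch]
      simp only [Real.exp_sub, Real.exp_log hu, ← Finset.sum_div]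
      rw [div_le_iff₀ hu, mul_comm]
      refine (Finset.sum_le_sum fun K _ => exp_scoreLog_le hout hr₁ hr₀ K z).trans ?_
      refine sum_keySet_prod_le hn hnu hp
        (fun i => Finset.sum_nonneg fun x _ => mul_nonneg measureReal_nonneg (hr₁ x).le)
        (fun i => Finset.sum_nonneg fun x _ => mul_nonneg measureReal_nonneg (hr₀ x).le)
        fun i => ?_
      have hw := weights_mem_stdSimplex (S := S) (M.query i z) (hout i z)
      rw [Finset.mul_sum, Finset.mul_sum, ← Finset.sum_add_distrib]
      refine le_of_le_of_eq (Finset.sum_le_sum fun x _ => ?_) hw.2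
      calc p * ((M.query i z).real {x.1} * r₁ x) + (1 - p) * ((M.query i z).real {x.1} * r₀ x)
          = (M.query i z).real {x.1} * (p * r₁ x + (1 - p) * r₀ x) := by ring
        _ ≤ (M.query i z).real {x.1} := mul_le_of_le_one_right measureReal_nonneg (hr x)
    have h4 := integral_mono_of_nonneg (μ := M.jointLaw.snd)
      (ae_of_all _ fun z => integral_nonneg fun K => (Real.exp_pos _).le)
      (integrable_const (1 : ℝ)) (ae_of_all _ h3)
    simpa using h4
  rw [h1]
  linarith

lemma isProbabilityMeasure_keyLaw (hn : 0 < n) (hnu : n < u) (hM : M.PermutationInvariant) :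
    IsProbabilityMeasure M.keyLaw := by
  obtain ⟨K, i, hi⟩ := exists_keySet_mem hn hnu
  rw [keyLaw_eq_outputLaw M hM K i hi]
  infer_instance

lemma isProbabilityMeasure_nonkeyLaw (hnu : n < u) (hM : M.PermutationInvariant) :
    IsProbabilityMeasure M.nonkeyLaw := by
  obtain ⟨K, i, hi⟩ := exists_keySet_notMem hnu
  rw [nonkeyLaw_eq_outputLaw M hM K i hi]
  infer_instance

lemma keyLaw_compl (hn : 0 < n) (hnu : n < u) (hM : M.PermutationInvariant)
    (hout : M.OutputsIn S) : M.keyLaw (S : Set unitInterval)ᶜ = 0 := by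
  obtain ⟨K, i, hi⟩ := exists_keySet_mem hn hnu
  rw [keyLaw_eq_outputLaw M hM K i hi]
  exact outputLaw_compl S.measurableSet hout K i

lemma nonkeyLaw_compl (hnu : n < u) (hM : M.PermutationInvariant)
    (hout : M.OutputsIn S) : M.nonkeyLaw (S : Set unitInterval)ᶜ = 0 := by
  obtain ⟨K, i, hi⟩ := exists_keySet_notMem hnu
  rw [nonkeyLaw_eq_outputLaw M hM K i hi]
  exact outputLaw_compl S.measurableSet hout K i

/-- The ideal ratio `a / m` may vanish, whereas a decoder needs positive ratios. Mixing it with `1`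
costs only `log (1 - δ)`. -/
lemma mul_log_mix_ge {a m δ : ℝ} (ha : 0 ≤ a) (hm : 0 ≤ m) (h : m = 0 → a = 0) (hδ : 0 < δ)
    (hδ1 : δ < 1) :
    a * Real.log a - a * Real.log m + a * Real.log (1 - δ)
      ≤ a * Real.log ((1 - δ) * (a / m) + δ) := by
  rcases ha.eq_or_lt with rfl | ha
  · simp
  have hm : 0 < m := lt_of_le_of_ne hm fun h' => ha.ne' (h h'.symm)
  have h1 : 0 < 1 - δ := by linarith
  rw [← mul_sub, ← mul_add]
  refine mul_le_mul_of_nonneg_left ?_ ha.le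
  rw [← Real.log_div ha.ne' hm.ne', ← Real.log_mul (by positivity) h1.ne']
  exact Real.log_le_log (by positivity) (by linarith)

/-- The single-letter lower bound on the information held in the memory. -/
theorem klDiv_jointLaw_ge (hn : 0 < n) (hnu : n < u) {p : ℝ} (hp : p = (n : ℝ) / u)
    (hM : M.PermutationInvariant) (hout : M.OutputsIn S) :
    ENNReal.ofReal (u * jsInfo p (weights S M.keyLaw) (weights S M.nonkeyLaw) - Real.log (u + 1))
      ≤ InformationTheory.klDiv M.jointLaw (M.jointLaw.fst.prod M.jointLaw.snd) := by
  have := isProbabilityMeasure_keyLaw hn hnu hM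
  have := isProbabilityMeasure_nonkeyLaw hnu hM
  have ha := weights_mem_stdSimplex M.keyLaw (keyLaw_compl hn hnu hM hout)
  have hb := weights_mem_stdSimplex M.nonkeyLaw (nonkeyLaw_compl hnu hM hout)
  set a := weights S M.keyLaw
  set b := weights S M.nonkeyLaw
  have hu : (0 : ℝ) < u := by exact_mod_cast hn.trans hnu
  have hp0 : 0 < p := by rw [hp]; positivity
  have hp1 : 0 < 1 - p := by
    rw [hp, sub_pos, div_lt_one hu]; exact_mod_cast hnu
  have hbound : ∀ δ ∈ Set.Ioo (0 : ℝ) 1,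
      ENNReal.ofReal (u * jsInfo p a b + u * Real.log (1 - δ) - Real.log (u + 1))
        ≤ InformationTheory.klDiv M.jointLaw (M.jointLaw.fst.prod M.jointLaw.snd) := by
    rintro δ ⟨hδ0, hδ1⟩
    have hδ' : 0 < 1 - δ := by linarith
    have hm0 : ∀ x, 0 ≤ p * a x + (1 - p) * b x := fun x =>
      add_nonneg (mul_nonneg hp0.le (ha.1 x)) (mul_nonneg hp1.le (hb.1 x))
    have hrpos : ∀ (c : S → ℝ), (∀ x, 0 ≤ c x) → ∀ x,
        0 < (1 - δ) * (c x / (p * a x + (1 - p) * b x)) + δ := fun c hc x =>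
      add_pos_of_nonneg_of_pos (mul_nonneg hδ'.le (div_nonneg (hc x) (hm0 x))) hδ0
    refine le_trans (ENNReal.ofReal_le_ofReal ?_) (klDiv_jointLaw_ge_of_decoder hn hnu hp hM hout
      (hrpos a ha.1) (hrpos b hb.1) fun x => ?_)
    · refine sub_le_sub_right ?_ _
      have hnp : (n : ℝ) = u * p := by rw [hp]; field_simp
      have h1 : u * jsInfo p a b + u * Real.log (1 - δ) = n * ∑ x, (a x * Real.log (a x)
          - a x * Real.log (p * a x + (1 - p) * b x) + a x * Real.log (1 - δ))
          + (u - n) * ∑ x, (b x * Real.log (b x)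
          - b x * Real.log (p * a x + (1 - p) * b x) + b x * Real.log (1 - δ)) := by
        have h2 : jsInfo p a b = p * ∑ x, (a x * Real.log (a x)
            - a x * Real.log (p * a x + (1 - p) * b x)) + (1 - p) * ∑ x, (b x * Real.log (b x)
            - b x * Real.log (p * a x + (1 - p) * b x)) := by
          rw [jsInfo, Finset.mul_sum, Finset.mul_sum, ← Finset.sum_add_distrib]
          exact Finset.sum_congr rfl fun x _ => by ring
        rw [Finset.sum_add_distrib, Finset.sum_add_distrib, ← Finset.sum_mul, ← Finset.sum_mul,
          ha.2, hb.2, h2, hnp]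
        ring
      rw [h1]
      have hnu' : (0 : ℝ) ≤ u - n := sub_nonneg.2 (by exact_mod_cast hnu.le)
      refine add_le_add (mul_le_mul_of_nonneg_left (Finset.sum_le_sum fun x _ => ?_)
        (Nat.cast_nonneg n)) (mul_le_mul_of_nonneg_left (Finset.sum_le_sum fun x _ => ?_) hnu')
      · exact mul_log_mix_ge (ha.1 x) (hm0 x)
          (fun h => by nlinarith [ha.1 x, mul_nonneg hp1.le (hb.1 x)]) hδ0 hδ1
      · exact mul_log_mix_ge (hb.1 x) (hm0 x)
          (fun h => by nlinarith [hb.1 x, mul_nonneg hp0.le (ha.1 x)]) hδ0 hδ1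
    -- An inequality, since the quotient is `0` at points where the mixture vanishes.
    · have h1 : (p * a x + (1 - p) * b x) / (p * a x + (1 - p) * b x) ≤ 1 := div_self_le_one _
      calc p * ((1 - δ) * (a x / (p * a x + (1 - p) * b x)) + δ)
          + (1 - p) * ((1 - δ) * (b x / (p * a x + (1 - p) * b x)) + δ)
          = (1 - δ) * ((p * a x + (1 - p) * b x) / (p * a x + (1 - p) * b x)) + δ := by ring
        _ ≤ (1 - δ) * 1 + δ := by gcongr
        _ = 1 := by ring
  have hlim : Tendsto (fun δ : ℝ => ENNReal.ofReal
      (u * jsInfo p a b + u * Real.log (1 - δ) - Real.log (u + 1))) (𝓝[>] 0)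
      (𝓝 (ENNReal.ofReal (u * jsInfo p a b - Real.log (u + 1)))) := by
    refine ENNReal.tendsto_ofReal ?_
    have h1 : ContinuousAt (fun δ : ℝ => u * jsInfo p a b + u * Real.log (1 - δ)
        - Real.log (u + 1)) 0 := by
      refine ContinuousAt.sub (ContinuousAt.add continuousAt_const (ContinuousAt.mul
        continuousAt_const (ContinuousAt.log (by fun_prop) (by norm_num)))) continuousAt_const
    have h2 := h1.tendsto.mono_left (nhdsWithin_le_nhds (s := Set.Ioi 0))
    simpa using h2
  exact le_of_tendsto hlim ((Ioo_mem_nhdsGT one_pos : Set.Ioo (0 : ℝ) 1 ∈ 𝓝[>] 0) |>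
    Filter.mem_of_superset <| hbound)

end LowerBound

end MembershipTester

/-! ### Channels and product weights: the tools for achievability. -/

section ProductWeights

/-- The information carried by a channel is at most its average divergence from any output
distribution. -/
lemma klSum_uniform_channel_le {κ Z : Type*} [Fintype κ] [Nonempty κ] [Fintype Z]
    {V : κ → Z → ℝ} (hV : ∀ k, V k ∈ stdSimplex ℝ Z) {ν : Z → ℝ} (hν : ν ∈ stdSimplex ℝ Z)
    (h : ∀ k z, ν z = 0 → V k z = 0) {N : ℝ} (hN : N = Fintype.card κ) :
    klSum (fun q : κ × Z => V q.1 q.2 / N) (fun q => 1 / N * ((∑ k, V k q.2) / N))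
      ≤ (∑ k, klSum (V k) ν) / N := by
  have hN0 : 0 < N := by rw [hN]; exact_mod_cast Fintype.card_pos
  set m : Z → ℝ := fun z => (∑ k, V k z) / N with hm
  have hm0 : ∀ z, 0 ≤ m z := fun z =>
    div_nonneg (Finset.sum_nonneg fun k _ => (hV k).1 z) hN0.le
  -- Replacing the output average `m` by `ν` adds `log (ν / m) ≤ ν / m - 1`, and these corrections
  -- have nonpositive total.
  have hterm : ∀ k z, V k z / N * Real.log (V k z / N / (1 / N * m z))
      ≤ V k z * Real.log (V k z / ν z) / N + (V k z / N * (ν z / m z) - V k z / N) := by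
    intro k z
    rcases ((hV k).1 z).eq_or_lt with h0 | h0
    · simp [← h0]
    · have hνz : 0 < ν z := lt_of_le_of_ne (hν.1 z) fun h' => h0.ne' (h k z h'.symm)
      have hmz : 0 < m z := by
        refine div_pos (h0.trans_le ?_) hN0
        exact Finset.single_le_sum (f := fun k => V k z) (fun k _ => (hV k).1 z)
          (Finset.mem_univ k)
      have h1 : V k z / N / (1 / N * m z) = V k z / ν z * (ν z / m z) := by
        field_simp
      rw [h1, Real.log_mul (by positivity) (by positivity)]
      have h2 := mul_le_mul_of_nonneg_left
        (Real.log_le_sub_one_of_pos (x := ν z / m z) (by positivity))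
        (by positivity : 0 ≤ V k z / N)
      calc V k z / N * (Real.log (V k z / ν z) + Real.log (ν z / m z))
          = V k z * Real.log (V k z / ν z) / N + V k z / N * Real.log (ν z / m z) := by ring
        _ ≤ _ := by linarith
  have hrest : ∑ k, ∑ z, (V k z / N * (ν z / m z) - V k z / N) ≤ 0 := by
    rw [Finset.sum_comm]
    have h1 : ∀ z, ∑ k, (V k z / N * (ν z / m z) - V k z / N) ≤ ν z - m z := by
      intro z
      rw [Finset.sum_sub_distrib, ← Finset.sum_mul, ← Finset.sum_div]
      change m z * (ν z / m z) - m z ≤ _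
      refine sub_le_sub_right ?_ _
      rw [mul_div_left_comm]
      exact mul_le_of_le_one_right (hν.1 z) (div_self_le_one _)
    refine (Finset.sum_le_sum fun z _ => h1 z).trans ?_
    rw [Finset.sum_sub_distrib, hν.2, ← Finset.sum_div, Finset.sum_comm,
      Finset.sum_congr rfl fun k _ => (hV k).2]
    simp [← hN, hN0.ne']
  rw [klSum, Fintype.sum_prod_type]
  refine (Finset.sum_le_sum fun k _ => Finset.sum_le_sum fun z _ => hterm k z).trans ?_
  simp only [Finset.sum_add_distrib, ← Finset.sum_div]
  simpa [klSum, ← Finset.sum_div] using hrest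

variable {I ι : Type*} [Fintype I] [DecidableEq I] [Fintype ι]

lemma sum_prod_apply (h : I → ι → ℝ) :
    ∑ w : I → ι, ∏ i, h i (w i) = ∏ i, ∑ x, h i x := by
  classical
  rw [Finset.prod_univ_sum, Fintype.piFinset_univ]

lemma prod_mem_stdSimplex {v : I → ι → ℝ} (hv : ∀ i, v i ∈ stdSimplex ℝ ι) :
    (fun w : I → ι => ∏ i, v i (w i)) ∈ stdSimplex ℝ (I → ι) := by
  refine ⟨fun w => Finset.prod_nonneg fun i _ => (hv i).1 _, ?_⟩
  rw [sum_prod_apply]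
  exact Finset.prod_eq_one fun i _ => (hv i).2

/-- Additivity of the divergence over products. -/
lemma klSum_prod {v m : I → ι → ℝ} (hv : ∀ i, v i ∈ stdSimplex ℝ ι)
    (h : ∀ i x, m i x = 0 → v i x = 0) :
    klSum (fun w : I → ι => ∏ i, v i (w i)) (fun w => ∏ i, m i (w i))
      = ∑ i, klSum (v i) (m i) := by
  -- Each summand of the logarithm is absorbed into its own factor, so the sum over `w` factorizes
  -- and the other factors sum to one.
  have h1 : ∀ w : I → ι, (∏ i, v i (w i)) * Real.log ((∏ i, v i (w i)) / ∏ i, m i (w i))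
      = ∑ i, ∏ j, (if j = i then v j (w j) * Real.log (v j (w j) / m j (w j))
          else v j (w j)) := by
    intro w
    have h2 : ∀ i, ∏ j, (if j = i then v j (w j) * Real.log (v j (w j) / m j (w j))
          else v j (w j)) = (∏ j, v j (w j)) * Real.log (v i (w i) / m i (w i)) := by
      intro i
      have h3 : ∀ j, (if j = i then v j (w j) * Real.log (v j (w j) / m j (w j))
          else v j (w j)) = v j (w j)
            * (if j = i then Real.log (v j (w j) / m j (w j)) else 1) := by
        intro j; split_ifs <;> simp
      rw [Finset.prod_congr rfl fun j _ => h3 j, Finset.prod_mul_distrib]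
      simp
    rw [Finset.sum_congr rfl fun i _ => h2 i, ← Finset.mul_sum]
    by_cases h0 : ∏ i, v i (w i) = 0
    · rw [h0, zero_mul, zero_mul]
    · rw [← Finset.prod_div_distrib, Real.log_prod]
      intro i _
      have hvi : v i (w i) ≠ 0 := Finset.prod_ne_zero_iff.1 h0 i (Finset.mem_univ i)
      exact div_ne_zero hvi fun h' => hvi (h i _ h')
  rw [klSum, Finset.sum_congr rfl fun w _ => h1 w, Finset.sum_comm]
  refine Finset.sum_congr rfl fun i _ => ?_
  rw [sum_prod_apply fun j x => if j = i then v j x * Real.log (v j x / m j x) else v j x,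
    Finset.prod_eq_single i]
  · simp [klSum]
  · intro j _ hj
    simpa [hj] using (hv j).2
  · simp

lemma klDiv_eq_klSum_of_fintype {α : Type*} [Fintype α] [MeasurableSpace α]
    [MeasurableSingletonClass α] {μ ν : Measure α} [IsProbabilityMeasure μ]
    [IsProbabilityMeasure ν] (h : μ ≪ ν) : InformationTheory.klDiv μ ν
      = ENNReal.ofReal (klSum (fun x => μ.real {x}) (fun x => ν.real {x})) := by
  rw [klDiv_eq_klSum (S := Finset.univ) (by simp) (by simp) h]
  congr 1
  exact Finset.sum_coe_sort Finset.univ fun x =>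
    μ.real {x} * Real.log (μ.real {x} / ν.real {x})

lemma jsInfo_eq_klSum {p : ℝ} (hp : p ∈ Set.Ioo (0 : ℝ) 1) {a b : ι → ℝ}
    (ha : a ∈ stdSimplex ℝ ι) (hb : b ∈ stdSimplex ℝ ι) :
    jsInfo p a b = p * klSum a (fun x => p * a x + (1 - p) * b x)
      + (1 - p) * klSum b (fun x => p * a x + (1 - p) * b x) := by
  have hp0 := hp.1
  have hp1 : 0 < 1 - p := by linarith [hp.2]
  rw [jsInfo, klSum, klSum, Finset.mul_sum, Finset.mul_sum, ← Finset.sum_add_distrib]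
  refine Finset.sum_congr rfl fun x _ => ?_
  have h1 : ∀ c : ℝ, (p * a x + (1 - p) * b x = 0 → c = 0) →
      c * Real.log (c / (p * a x + (1 - p) * b x))
        = c * Real.log c - c * Real.log (p * a x + (1 - p) * b x) := by
    intro c hc
    by_cases h0 : c = 0
    · simp [h0]
    · rw [Real.log_div h0 fun h' => h0 (hc h'), mul_sub]
  rw [h1 (a x) fun h => by nlinarith [ha.1 x, mul_nonneg hp1.le (hb.1 x)],
    h1 (b x) fun h => by nlinarith [hb.1 x, mul_nonneg hp0.le (ha.1 x)]]
  ring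

end ProductWeights

/-! ### The tester storing independent answers. -/

namespace MembershipTester

variable {S : Finset unitInterval} {a b : S → ℝ}

lemma ite_mem_stdSimplex (ha : a ∈ stdSimplex ℝ S) (hb : b ∈ stdSimplex ℝ S) (c : Prop)
    [Decidable c] : (if c then a else b) ∈ stdSimplex ℝ S := by
  split_ifs
  exacts [ha, hb]

lemma map_prod_pi_eval {u : ℕ} (μ : Fin u → Measure S) [∀ i, IsProbabilityMeasure (μ i)]
    (i : Fin u) : ((Measure.dirac ()).prod (Measure.pi μ)).map
      (fun z : Unit × (Fin u → S) => (z.2 i : unitInterval)) = (μ i).map Subtype.val := by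
  have h : (fun z : Unit × (Fin u → S) => (z.2 i : unitInterval))
      = (Subtype.val ∘ Function.eval i) ∘ Prod.snd := rfl
  rw [h, ← Measure.map_map (by fun_prop) measurable_snd]
  change Measure.map _ (Measure.snd _) = _
  rw [Measure.snd_prod, ← Measure.map_map (by fun_prop) (by fun_prop),
    (measurePreserving_eval _ i).map_eq]

lemma prod_pi_weightMeasure_real {u : ℕ} {v : Fin u → S → ℝ} (hv : ∀ i, v i ∈ stdSimplex ℝ S)
    (z : Unit × (Fin u → S)) :
    ((Measure.dirac ()).prod (Measure.pi fun i => weightMeasure (v i))).real {z}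
      = ∏ i, v i (z.2 i) := by
  have : ∀ i, IsProbabilityMeasure (weightMeasure (v i)) :=
    fun i => isProbabilityMeasure_weightMeasure (hv i)
  obtain ⟨⟨⟩, w⟩ := z
  rw [measureReal_def, ← Set.singleton_prod_singleton, Measure.prod_prod, Measure.pi_singleton]
  simp only [weightMeasure_singleton, Measure.dirac_apply_of_mem (Set.mem_singleton ()), one_mul]
  rw [ENNReal.toReal_prod]
  exact Finset.prod_congr rfl fun i _ => ENNReal.toReal_ofReal ((hv i).1 _)

/-- The tester that stores independent answers to all queries, drawn with weights `a` for the keys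
and `b` for the non-keys. -/
noncomputable def independentTester (u n : ℕ) (ha : a ∈ stdSimplex ℝ S) (hb : b ∈ stdSimplex ℝ S) :
    MembershipTester u n where
  Seed := Unit
  State := Fin u → S
  seedLaw := Measure.dirac ()
  init K := Kernel.const Unit (Measure.pi fun i => weightMeasure (if i ∈ K.1 then a else b))
  isMarkov_init K := by
    have : ∀ i : Fin u, IsProbabilityMeasure (weightMeasure (if i ∈ K.1 then a else b)) :=
      fun i => isProbabilityMeasure_weightMeasure (ite_mem_stdSimplex ha hb _)
    infer_instance
  query i := Kernel.deterministic (fun z => (z.2 i : unitInterval)) (by fun_prop)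

variable {u n : ℕ} (ha : a ∈ stdSimplex ℝ S) (hb : b ∈ stdSimplex ℝ S)

lemma memoryLaw_independentTester (K : KeySet u n) :
    (independentTester u n ha hb).memoryLaw K
      = (Measure.dirac ()).prod (Measure.pi fun i => weightMeasure (if i ∈ K.1 then a else b)) := by
  have : ∀ i : Fin u, IsProbabilityMeasure (weightMeasure (if i ∈ K.1 then a else b)) :=
    fun i => isProbabilityMeasure_weightMeasure (ite_mem_stdSimplex ha hb _)
  exact Measure.compProd_const (μ := (Measure.dirac () : Measure Unit))
    (ν := Measure.pi fun i => weightMeasure (if i ∈ K.1 then a else b))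

lemma outputLaw_independentTester (K : KeySet u n) (i : Fin u) :
    (independentTester u n ha hb).outputLaw K i
      = (weightMeasure (if i ∈ K.1 then a else b)).map Subtype.val := by
  have : ∀ i : Fin u, IsProbabilityMeasure (weightMeasure (if i ∈ K.1 then a else b)) :=
    fun i => isProbabilityMeasure_weightMeasure (ite_mem_stdSimplex ha hb _)
  have h1 : (independentTester u n ha hb).outputLaw K i
      = ((independentTester u n ha hb).memoryLaw K).map
        (fun z : Unit × (Fin u → S) => (z.2 i : unitInterval)) :=
    Measure.deterministic_comp_eq_map (by fun_prop)
  exact h1.trans ((congrArg (Measure.map _) (memoryLaw_independentTester ha hb K)).trans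
    (map_prod_pi_eval (fun i => weightMeasure (if i ∈ K.1 then a else b)) i))

lemma permutationInvariant_independentTester :
    (independentTester u n ha hb).PermutationInvariant := by
  intro π K i
  rw [outputLaw_independentTester, outputLaw_independentTester]
  have : π i ∈ (K.permute π).1 ↔ i ∈ K.1 := by simp [KeySet.permute]
  simp only [this]

lemma outputsIn_independentTester : (independentTester u n ha hb).OutputsIn S := by
  intro i z
  have h : (independentTester u n ha hb).query i z
      = Measure.dirac ((z.2 : Fin u → S) i : unitInterval) :=
    Kernel.deterministic_apply
      (by fun_prop : Measurable fun z : Unit × (Fin u → S) => (z.2 i : unitInterval)) z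
  rw [h, Measure.dirac_apply' _ S.measurableSet.compl]
  simp

lemma keyLaw_independentTester (hn : 0 < n) (hnu : n < u) :
    (independentTester u n ha hb).keyLaw = (weightMeasure a).map Subtype.val := by
  obtain ⟨K, i, hi⟩ := exists_keySet_mem hn hnu
  rw [keyLaw_eq_outputLaw _ (permutationInvariant_independentTester ha hb) K i hi,
    outputLaw_independentTester, if_pos hi]

lemma nonkeyLaw_independentTester (hnu : n < u) :
    (independentTester u n ha hb).nonkeyLaw = (weightMeasure b).map Subtype.val := by
  obtain ⟨K, i, hi⟩ := exists_keySet_notMem hnu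
  rw [nonkeyLaw_eq_outputLaw _ (permutationInvariant_independentTester ha hb) K i hi,
    outputLaw_independentTester, if_neg hi]

lemma memoryLaw_independentTester_real (K : KeySet u n) (z : Unit × (Fin u → S)) :
    ((independentTester u n ha hb).memoryLaw K).real {z}
      = ∏ i, (if i ∈ K.1 then a else b) (z.2 i) := by
  exact (congrArg (fun μ => μ.real {z}) (memoryLaw_independentTester ha hb K)).trans
    (prod_pi_weightMeasure_real (fun i => ite_mem_stdSimplex ha hb _) z)

lemma jointLaw_real_singleton (hnu : n < u) (M : MembershipTester u n)
    [MeasurableSingletonClass (M.Seed × M.State)]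
    (K : KeySet u n) (z : M.Seed × M.State) :
    M.jointLaw.real {(K, z)} = (M.memoryLaw K).real {z} / u.choose n := by
  have := isProbabilityMeasure_uniformOn_keySet hnu
  rw [measureReal_def, jointLaw, ← Set.singleton_prod_singleton,
    Measure.compProd_apply_prod (measurableSet_singleton _) (measurableSet_singleton _),
    lintegral_singleton, ENNReal.toReal_mul, uniformOn_univ, Measure.count_singleton, card_keySet]
  simp [div_eq_mul_inv, measureReal_def, memoryKernel]

lemma jointLaw_fst_real_singleton (hnu : n < u) (M : MembershipTester u n) (K : KeySet u n) :
    M.jointLaw.fst.real {K} = 1 / u.choose n := by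
  have := isProbabilityMeasure_uniformOn_keySet hnu
  rw [measureReal_def, jointLaw, Measure.fst_compProd, uniformOn_univ, Measure.count_singleton,
    card_keySet]
  simp

lemma jointLaw_snd_real_singleton (hnu : n < u) (M : MembershipTester u n)
    [MeasurableSingletonClass (M.Seed × M.State)] (z : M.Seed × M.State) :
    M.jointLaw.snd.real {z} = (∑ K, (M.memoryLaw K).real {z}) / u.choose n := by
  have := isProbabilityMeasure_uniformOn_keySet hnu
  rw [← integral_uniformOn_keySet, measureReal_def, jointLaw, Measure.snd_compProd,
    Measure.bind_apply (measurableSet_singleton _) M.memoryKernel.measurable.aemeasurable]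
  exact (integral_toReal (M.memoryKernel.measurable_coe (measurableSet_singleton _)).aemeasurable
    (ae_of_all _ fun z => measure_lt_top _ _)).symm

/-- With finite memory the joint law is a channel with uniform input, and any reference law `ν` may
replace the true memory marginal, which need not be a product. -/
lemma klDiv_jointLaw_le {M : MembershipTester u n} [Fintype (M.Seed × M.State)]
    [MeasurableSingletonClass (M.Seed × M.State)] (hnu : n < u)
    {ν : M.Seed × M.State → ℝ} (hν : ν ∈ stdSimplex ℝ (M.Seed × M.State))
    (h : ∀ K z, ν z = 0 → (M.memoryLaw K).real {z} = 0) :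
    InformationTheory.klDiv M.jointLaw (M.jointLaw.fst.prod M.jointLaw.snd)
      ≤ ENNReal.ofReal ((∑ K, klSum (fun z => (M.memoryLaw K).real {z}) ν) / u.choose n) := by
  have hunif := isProbabilityMeasure_uniformOn_keySet hnu
  have hne := nonempty_keySet hnu
  have hjoint : IsProbabilityMeasure M.jointLaw := by
    unfold jointLaw; infer_instance
  have hV : ∀ K, (fun z => (M.memoryLaw K).real {z}) ∈ stdSimplex ℝ (M.Seed × M.State) :=
    fun K => ⟨fun _ => measureReal_nonneg, by
      have h1 := (weights_mem_stdSimplex (S := Finset.univ) (M.memoryLaw K) (by simp)).2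
      rwa [← Finset.sum_coe_sort Finset.univ]⟩
  have hac : M.jointLaw ≪ M.jointLaw.fst.prod M.jointLaw.snd := by
    refine absolutelyContinuous_of_singleton (S := Finset.univ) (by simp) ?_
    rintro ⟨K, z⟩ - h0
    rw [← Set.singleton_prod_singleton, Measure.prod_prod, mul_eq_zero] at h0
    rcases h0 with h0 | h0
    · rw [Measure.fst_apply (measurableSet_singleton _)] at h0
      exact measure_mono_null (by simp) h0
    · rw [Measure.snd_apply (measurableSet_singleton _)] at h0
      exact measure_mono_null (by simp) h0
  rw [klDiv_eq_klSum_of_fintype hac]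
  refine ENNReal.ofReal_le_ofReal (le_of_eq_of_le ?_ (klSum_uniform_channel_le hV hν h
    (by rw [card_keySet])))
  congr 1
  · ext ⟨K, z⟩
    exact jointLaw_real_singleton hnu M K z
  · ext ⟨K, z⟩
    rw [measureReal_def, ← Set.singleton_prod_singleton, Measure.prod_prod, ENNReal.toReal_mul]
    exact congrArg₂ _ (jointLaw_fst_real_singleton hnu M K) (jointLaw_snd_real_singleton hnu M z)

/-- The information held by the tester storing independent answers is at most the single-letter
information per element of the universe. -/
theorem klDiv_jointLaw_independentTester_le (hn : 0 < n) (hnu : n < u) {p : ℝ}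
    (hp : p = (n : ℝ) / u) :
    InformationTheory.klDiv (independentTester u n ha hb).jointLaw
      ((independentTester u n ha hb).jointLaw.fst.prod (independentTester u n ha hb).jointLaw.snd)
      ≤ ENNReal.ofReal (u * jsInfo p a b) := by
  classical
  have hu : (0 : ℝ) < u := by exact_mod_cast hn.trans hnu
  have hp0 : 0 < p := by rw [hp]; positivity
  have hp1 : 0 < 1 - p := by
    rw [hp, sub_pos, div_lt_one hu]; exact_mod_cast hnu
  have hpI : p ∈ Set.Ioo (0 : ℝ) 1 := ⟨hp0, by linarith⟩
  have hm : (fun x => p * a x + (1 - p) * b x) ∈ stdSimplex ℝ S := by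
    refine ⟨fun x => add_nonneg (mul_nonneg hp0.le (ha.1 x)) (mul_nonneg hp1.le (hb.1 x)), ?_⟩
    rw [Finset.sum_add_distrib, ← Finset.mul_sum, ← Finset.mul_sum, ha.2, hb.2]
    ring
  set m : S → ℝ := fun x => p * a x + (1 - p) * b x with hm_def
  have hzero : ∀ (c : Prop) [Decidable c] (x : S), m x = 0 → (if c then a else b) x = 0 := by
    intro c _ x hx
    have h1 := mul_nonneg hp0.le (ha.1 x)
    have h2 := mul_nonneg hp1.le (hb.1 x)
    have h3 : p * a x + (1 - p) * b x = 0 := hx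
    split_ifs
    · exact (mul_eq_zero.1 (by linarith : p * a x = 0)).resolve_left hp0.ne'
    · exact (mul_eq_zero.1 (by linarith : (1 - p) * b x = 0)).resolve_left hp1.ne'
  let : Fintype ((independentTester u n ha hb).Seed × (independentTester u n ha hb).State) :=
    inferInstanceAs (Fintype (Unit × (Fin u → S)))
  have : MeasurableSingletonClass
      ((independentTester u n ha hb).Seed × (independentTester u n ha hb).State) :=
    inferInstanceAs (MeasurableSingletonClass (Unit × (Fin u → S)))
  -- The reference law is the product of the mixtures. From it, every key set has the same
  -- divergence `n KL(a‖m) + (u - n) KL(b‖m)`.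
  have hν : (fun z : Unit × (Fin u → S) => ∏ i, m (z.2 i)) ∈ stdSimplex ℝ _ := by
    have h1 := prod_mem_stdSimplex (I := Fin u) fun _ => hm
    refine ⟨fun z => h1.1 z.2, ?_⟩
    rw [Fintype.sum_prod_type]
    simpa using h1.2
  refine (klDiv_jointLaw_le hnu hν fun K z hz => ?_).trans (ENNReal.ofReal_le_ofReal ?_)
  · refine (memoryLaw_independentTester_real ha hb K z).trans ?_
    obtain ⟨i, -, hi⟩ := Finset.prod_eq_zero_iff.1 hz
    exact Finset.prod_eq_zero (Finset.mem_univ i) (hzero _ _ hi)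
  · have h1 : ∀ K : KeySet u n, klSum
        (fun z => ((independentTester u n ha hb).memoryLaw K).real {z})
        (fun z : Unit × (Fin u → S) => ∏ i, m (z.2 i)) = u * jsInfo p a b := by
      intro K
      have h2 : (fun z => ((independentTester u n ha hb).memoryLaw K).real {z})
          = fun z : Unit × (Fin u → S) => ∏ i, (if i ∈ K.1 then a else b) (z.2 i) :=
        funext fun z => memoryLaw_independentTester_real ha hb K z
      have h3 := klSum_prod (v := fun i : Fin u => if i ∈ K.1 then a else b) (m := fun _ => m)
        (fun i => ite_mem_stdSimplex ha hb _) fun i x => hzero _ x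
      have h4 : ∀ i : Fin u, klSum (if i ∈ K.1 then a else b) m
          = if i ∈ K.1 then klSum a m else klSum b m := fun i => by split_ifs <;> rfl
      rw [Finset.sum_congr rfl fun i _ => h4 i, sum_ite_keySet] at h3
      have hnp : (n : ℝ) = u * p := by rw [hp]; field_simp
      have h5 : u * jsInfo p a b = n * klSum a m + (u - n) * klSum b m := by
        rw [jsInfo_eq_klSum hpI ha hb, hnp]; ring
      rw [h5, ← h3, h2]
      change ∑ z : Unit × (Fin u → S), _ = _
      rw [Fintype.sum_prod_type]
      simp [klSum]
    have hch : (u.choose n : ℝ) ≠ 0 := by exact_mod_cast (Nat.choose_pos hnu.le).ne'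
    refine le_of_eq ?_
    rw [div_eq_iff hch]
    refine (Finset.sum_congr rfl fun K _ => h1 K).trans ?_
    rw [Finset.sum_const, Finset.card_univ, card_keySet, nsmul_eq_mul, mul_comm]

end MembershipTester

/-! ### Transfer of the minimization from measures to weights. -/

section KLBits

lemma jsInfo_nonneg {ι : Type*} [Fintype ι] {p : ℝ} (hp : p ∈ Set.Ioo (0 : ℝ) 1) {a b : ι → ℝ}
    (ha : a ∈ stdSimplex ℝ ι) (hb : b ∈ stdSimplex ℝ ι) : 0 ≤ jsInfo p a b := by
  refine le_of_eq_of_le ?_ (le_jsInfo hp ha hb (g := fun _ => 1) fun _ => one_pos)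
  simp only [Real.log_one, mul_zero, one_mul, zero_sub, Finset.sum_add_distrib,
    Finset.sum_neg_distrib, ← Finset.mul_sum, ha.2, hb.2]
  ring

lemma klSum_nonneg {ι : Type*} [Fintype ι] {a b : ι → ℝ} (ha : a ∈ stdSimplex ℝ ι)
    (hb : b ∈ stdSimplex ℝ ι) (h : ∀ x, b x = 0 → a x = 0) : 0 ≤ klSum a b := by
  have h1 : ∑ x, (a x - b x) = 0 := by rw [Finset.sum_sub_distrib, ha.2, hb.2, sub_self]
  rw [← h1]
  refine Finset.sum_le_sum fun x _ => ?_
  by_cases h0 : a x = 0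
  · simpa [h0] using hb.1 x
  · have h2 := mul_log_sub_mul_log_ge (ha.1 x) (hb.1 x) one_pos (h x)
    rw [Real.log_one] at h2
    rw [Real.log_div h0 fun h' => h0 (h x h')]
    linarith

variable {α : Type*} [MeasurableSpace α] [MeasurableSingletonClass α] {S : Finset α}

lemma klBits_map_weightMeasure {a b : S → ℝ} (ha : a ∈ stdSimplex ℝ S)
    (hb : b ∈ stdSimplex ℝ S) (h : ∀ x, b x = 0 → a x = 0) :
    klBits ((weightMeasure a).map Subtype.val) ((weightMeasure b).map Subtype.val)
      = ENNReal.ofReal (klSum a b) / ENNReal.ofReal (Real.log 2) := by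
  have := isProbabilityMeasure_weightMeasure ha
  have := isProbabilityMeasure_weightMeasure hb
  have : IsProbabilityMeasure ((weightMeasure a).map (Subtype.val : S → α)) :=
    Measure.isProbabilityMeasure_map (by fun_prop)
  have : IsProbabilityMeasure ((weightMeasure b).map (Subtype.val : S → α)) :=
    Measure.isProbabilityMeasure_map (by fun_prop)
  rw [klBits, klDiv_eq_klSum (S := S) (map_weightMeasure_compl a) (map_weightMeasure_compl b),
    weights_map_weightMeasure ha.1, weights_map_weightMeasure hb.1]
  refine absolutelyContinuous_of_singleton (map_weightMeasure_compl a) fun x hx h0 => ?_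
  rw [map_weightMeasure_singleton b ⟨x, hx⟩, ENNReal.ofReal_eq_zero] at h0
  rw [map_weightMeasure_singleton a ⟨x, hx⟩, h _ (le_antisymm h0 (hb.1 _)), ENNReal.ofReal_zero]

lemma weights_mem_feasibleWeights (μ : Measure α) [IsProbabilityMeasure μ]
    (hμ : μ (S : Set α)ᶜ = 0) {d : α → ℝ≥0∞} {ε : ℝ≥0∞} (h : ∫⁻ x, d x ∂μ ≤ ε) :
    weights S μ ∈ feasibleWeights (fun x : S => d x) ε := by
  refine ⟨weights_mem_stdSimplex μ hμ, le_of_eq_of_le ?_ h⟩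
  rw [lintegral_eq_sum_of_compl_null hμ]
  simp [weights, ofReal_measureReal]

/-- A minimizing pair of output laws with finitely supported law on non-keys minimizes the
divergence among feasible weight functions on that support. -/
lemma klSum_weights_le {dK dN : unitInterval → ℝ≥0∞} {εK εN : ℝ≥0}
    {μK μN : ProbabilityMeasure unitInterval} (hmin : IsUniqueKLMinimizer dK dN εK εN μK μN)
    {S : Finset unitInterval} (hK : (μK : Measure unitInterval) (S : Set unitInterval)ᶜ = 0)
    (hN : (μN : Measure unitInterval) (S : Set unitInterval)ᶜ = 0)
    (hac : (μK : Measure unitInterval) ≪ μN) {a b : S → ℝ}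
    (ha : a ∈ feasibleWeights (fun x : S => dK x) εK)
    (hb : b ∈ feasibleWeights (fun x : S => dN x) εN) (h : ∀ x, b x = 0 → a x = 0) :
    klSum (weights S (μK : Measure unitInterval)) (weights S (μN : Measure unitInterval))
        ≤ klSum a b ∧
      (klSum a b ≤ klSum (weights S (μK : Measure unitInterval))
          (weights S (μN : Measure unitInterval)) →
        a = weights S (μK : Measure unitInterval) ∧
          b = weights S (μN : Measure unitInterval)) := by
  have := isProbabilityMeasure_weightMeasure ha.1
  have := isProbabilityMeasure_weightMeasure hb.1
  let νK : ProbabilityMeasure unitInterval :=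
    ⟨(weightMeasure a).map Subtype.val, Measure.isProbabilityMeasure_map (by fun_prop)⟩
  let νN : ProbabilityMeasure unitInterval :=
    ⟨(weightMeasure b).map Subtype.val, Measure.isProbabilityMeasure_map (by fun_prop)⟩
  have hνK : νK ∈ feasible dK εK := (lintegral_map_weightMeasure a dK).trans_le ha.2
  have hνN : νN ∈ feasible dN εN := (lintegral_map_weightMeasure b dN).trans_le hb.2
  have hkl : klBits (νK : Measure unitInterval) νN
      = ENNReal.ofReal (klSum a b) / ENNReal.ofReal (Real.log 2) :=
    klBits_map_weightMeasure ha.1 hb.1 h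
  have hkl' : klBits (μK : Measure unitInterval) μN
      = ENNReal.ofReal (klSum (weights S (μK : Measure unitInterval))
        (weights S (μN : Measure unitInterval))) / ENNReal.ofReal (Real.log 2) := by
    rw [klBits, klDiv_eq_klSum hK hN hac]
  have hle : klSum (weights S (μK : Measure unitInterval))
      (weights S (μN : Measure unitInterval)) ≤ klSum a b := by
    have h1 := hmin.le νK hνK νN hνN
    rw [hkl, hkl', ENNReal.div_le_iff_le_mul
      (Or.inl (ENNReal.ofReal_pos.2 (Real.log_pos one_lt_two)).ne')
      (Or.inl ENNReal.ofReal_ne_top), ENNReal.div_mul_cancel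
      (ENNReal.ofReal_pos.2 (Real.log_pos one_lt_two)).ne' ENNReal.ofReal_ne_top] at h1
    exact (ENNReal.ofReal_le_ofReal_iff (klSum_nonneg ha.1 hb.1 h)).1 h1
  refine ⟨hle, fun hge => ?_⟩
  obtain ⟨h1, h2⟩ := hmin.unique νK hνK νN hνN (by rw [hkl, hkl', le_antisymm hge hle])
  have h3 : (weightMeasure a).map Subtype.val = (μK : Measure unitInterval) :=
    congrArg ProbabilityMeasure.toMeasure h1
  have h4 : (weightMeasure b).map Subtype.val = (μN : Measure unitInterval) :=
    congrArg ProbabilityMeasure.toMeasure h2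
  rw [← h3, ← h4, weights_map_weightMeasure ha.1.1, weights_map_weightMeasure hb.1.1]
  exact ⟨rfl, rfl⟩

/-- A point of a finite support is isolated in it: deleting the other support points leaves a
neighbourhood whose mass is carried by the point alone. -/
lemma measure_singleton_ne_zero_of_finite_support {μ : Measure unitInterval}
    (hfin : μ.support.Finite) {x : unitInterval} (hx : x ∈ μ.support) : μ {x} ≠ 0 := by
  intro h0
  have hopen : (μ.support \ {x})ᶜ ∈ 𝓝 x :=
    (hfin.subset Set.sdiff_subset).isClosed.isOpen_compl.mem_nhds (by simp)
  have h1 := (Measure.mem_support_iff_forall x).1 hx _ hopen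
  refine h1.ne' (measure_mono_null (t := μ.supportᶜ ∪ {x}) ?_
    (measure_union_null Measure.measure_compl_support h0))
  intro y hy
  by_cases hyx : y = x
  · exact Or.inr hyx
  · exact Or.inl fun hys => hy ⟨hys, hyx⟩

end KLBits

/-! ### Asymptotics along sequences of testers. -/

section Sequences

lemma density_bounds {p : ℚ} (hp0 : 0 < p) (hp1 : p < 1) {n u : ℕ}
    (h : (n : ℚ) / (u : ℚ) = p) : 0 < n ∧ n < u ∧ (p : ℝ) = (n : ℝ) / u := by
  -- Division by zero yields zero, so a positive density excludes an empty universe.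
  have hu : 0 < u := Nat.pos_of_ne_zero fun h0 => by simp [h0] at h; exact hp0.ne h
  have hn : 0 < n := Nat.pos_of_ne_zero fun h0 => by simp [h0] at h; exact hp0.ne h
  refine ⟨hn, ?_, ?_⟩
  · rw [← h, div_lt_one (by exact_mod_cast hu)] at hp1
    exact_mod_cast hp1
  · rw [← h]; push_cast; rfl

lemma tendsto_log_div_of_density {p : ℝ} {n u : ℕ → ℕ} (hn : Tendsto n atTop atTop)
    (hu : Tendsto u atTop atTop) (hpos : ∀ j, 0 < n j) (hp : ∀ j, p = (n j : ℝ) / u j)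
    (hp0 : 0 < p) : Tendsto (fun j => Real.log (u j + 1) / n j) atTop (𝓝 0) := by
  have h1 : Tendsto (fun j => (u j : ℝ) + 1) atTop atTop :=
    tendsto_atTop_add_const_right _ _ (tendsto_natCast_atTop_atTop.comp hu)
  have h2 : Tendsto (fun j => Real.log (u j + 1) / ((u j : ℝ) + 1)) atTop (𝓝 0) :=
    (Real.isLittleO_log_id_atTop.tendsto_div_nhds_zero).comp h1
  have h3 : Tendsto (fun j => p⁻¹ + ((n j : ℝ))⁻¹) atTop (𝓝 (p⁻¹ + 0)) :=
    tendsto_const_nhds.add (tendsto_inv_atTop_zero.comp (tendsto_natCast_atTop_atTop.comp hn))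
  have h4 := h2.mul h3
  rw [zero_mul] at h4
  refine h4.congr fun j => ?_
  have hn' : (0 : ℝ) < n j := by exact_mod_cast hpos j
  have hu' : (u j : ℝ) = n j / p := by
    have h5 : (u j : ℝ) ≠ 0 := fun h0 => by
      have := hp j; rw [h0, div_zero] at this; exact hp0.ne' this
    rw [hp j]; field_simp
  have h5 : p⁻¹ + (n j : ℝ)⁻¹ = ((u j : ℝ) + 1) / n j := by
    rw [hu']; field_simp
  have h6 : (u j : ℝ) + 1 ≠ 0 := by positivity
  rw [h5]
  field_simp

/-- Limits of weight functions of asymptotic cost at most `ε` are feasible. -/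
lemma mem_feasibleWeights_of_tendsto {ι : Type*} [Fintype ι] {d : ι → ℝ≥0∞} {ε : ℝ≥0∞}
    {a : ℕ → ι → ℝ} {c : ℕ → ℝ≥0∞} (ha : ∀ j, a j ∈ feasibleWeights d (c j))
    (hc : limsup c atTop ≤ ε) {U : Ultrafilter ℕ} (hU : (U : Filter ℕ) ≤ atTop) {a₀ : ι → ℝ}
    (hlim : Tendsto a U (𝓝 a₀)) : a₀ ∈ feasibleWeights d ε := by
  -- The cost is only asymptotically at most `ε`, so closedness is applied at every larger level.
  have h1 : ∀ ε' > ε, a₀ ∈ feasibleWeights d ε' := by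
    intro ε' hε'
    refine (isClosed_feasibleWeights d ε').mem_of_tendsto hlim ?_
    filter_upwards [hU (eventually_lt_of_limsup_lt (hc.trans_lt hε'))] with j hj
    exact ⟨(ha j).1, (ha j).2.trans hj.le⟩
  refine ⟨(isClosed_stdSimplex ℝ ι).mem_of_tendsto hlim (Eventually.of_forall fun j => (ha j).1),
    le_of_forall_gt fun ε' hε' => ?_⟩
  obtain ⟨ε'', h2, h3⟩ := exists_between hε'
  exact ((h1 ε'' h2).2).trans_lt h3

variable {dK dN : unitInterval → ℝ≥0∞} {εK εN : ℝ≥0} {S : Finset unitInterval}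

lemma budget_div_eq {u n : ℕ} (M : MembershipTester u n) : M.budget / (n : ℝ≥0∞)
    = InformationTheory.klDiv M.jointLaw (M.jointLaw.fst.prod M.jointLaw.snd)
      / ENNReal.ofReal (Real.log 2) / n := rfl

lemma ofReal_div_log_two_div {t : ℝ} {n : ℕ} (hn : 0 < n) :
    ENNReal.ofReal t / ENNReal.ofReal (Real.log 2) / n
      = ENNReal.ofReal (t / Real.log 2 / n) := by
  rw [ENNReal.ofReal_div_of_pos (by exact_mod_cast hn),
    ENNReal.ofReal_div_of_pos (Real.log_pos one_lt_two), ENNReal.ofReal_natCast]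

/-- The minimal single-letter information is an asymptotic lower bound on the memory per key. -/
theorem le_liminf_budget {p : ℚ} (hp0 : 0 < p) (hp1 : p < 1) {c : ℝ}
    (hc : ∀ a ∈ feasibleWeights (fun x : S => dK x) εK,
      ∀ b ∈ feasibleWeights (fun x : S => dN x) εN, c ≤ jsInfo p a b / p / Real.log 2)
    {n u : ℕ → ℕ} {M : ∀ j, MembershipTester (u j) (n j)}
    (hM : IsTesterSequence dK dN εK εN S p n u M) :
    (c : EReal) ≤ liminf (fun j => (((M j).budget / (n j : ℝ≥0∞) : ℝ≥0∞) : EReal)) atTop := by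
  have hb := fun j => density_bounds hp0 hp1 (hM.density j)
  have hpR : (0 : ℝ) < p := by exact_mod_cast hp0
  have hlog : 0 < Real.log 2 := Real.log_pos one_lt_two
  set a : ℕ → S → ℝ := fun j => weights S (M j).keyLaw with ha_def
  set b : ℕ → S → ℝ := fun j => weights S (M j).nonkeyLaw with hb_def
  have ha : ∀ j, a j ∈ feasibleWeights (fun x : S => dK x) ((M j).keyError dK) := fun j =>
    have := MembershipTester.isProbabilityMeasure_keyLaw (hb j).1 (hb j).2.1 (hM.invariant j)
    weights_mem_feasibleWeights _ (MembershipTester.keyLaw_compl (hb j).1 (hb j).2.1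
      (hM.invariant j) (hM.outputsIn j)) le_rfl
  have hbw : ∀ j, b j ∈ feasibleWeights (fun x : S => dN x) ((M j).nonkeyError dN) := fun j =>
    have := MembershipTester.isProbabilityMeasure_nonkeyLaw (hb j).2.1 (hM.invariant j)
    weights_mem_feasibleWeights _ (MembershipTester.nonkeyLaw_compl (hb j).2.1
      (hM.invariant j) (hM.outputsIn j)) le_rfl
  have hlow : ∀ j, ((jsInfo p (a j) (b j) / p - Real.log (u j + 1) / n j) / Real.log 2 : ℝ)
      ≤ (((M j).budget / (n j : ℝ≥0∞) : ℝ≥0∞) : EReal) := by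
    intro j
    obtain ⟨hn, hnu, hpj⟩ := hb j
    have h1 := MembershipTester.klDiv_jointLaw_ge hn hnu hpj (hM.invariant j) (hM.outputsIn j)
    have h2 : ENNReal.ofReal ((u j * jsInfo p (a j) (b j) - Real.log (u j + 1))
        / Real.log 2 / n j) ≤ (M j).budget / (n j : ℝ≥0∞) := by
      rw [← ofReal_div_log_two_div hn, budget_div_eq]
      gcongr
    have h3 : (u j * jsInfo p (a j) (b j) - Real.log (u j + 1)) / Real.log 2 / n j
        = (jsInfo p (a j) (b j) / p - Real.log (u j + 1) / n j) / Real.log 2 := by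
      have hn' : (n j : ℝ) ≠ 0 := by exact_mod_cast hn.ne'
      have hu' : (u j : ℝ) ≠ 0 := by exact_mod_cast (hn.trans hnu).ne'
      rw [hpj]; field_simp
    rw [h3] at h2
    refine le_trans ?_ (EReal.coe_ennreal_le_coe_ennreal_iff.2 h2)
    rw [EReal.coe_ennreal_ofReal]
    exact EReal.coe_le_coe_iff.2 (le_max_left _ _)
  refine le_of_forall_lt fun c' hc' => ?_
  obtain ⟨c'', h1, h2⟩ := exists_between hc'
  refine h1.trans_le (le_liminf_of_le (by isBoundedDefault) ?_)
  -- Ultrafilters play the role of subsequences: along each one the pair of output laws converges,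
  -- to a feasible pair.
  refine mem_iff_ultrafilter.2 fun U hU => ?_
  have hcomp := (isCompact_stdSimplex ℝ S).prod (isCompact_stdSimplex ℝ S)
  obtain ⟨⟨a₀, b₀⟩, -, hlim⟩ := isCompact_iff_ultrafilter_le_nhds.1 hcomp
    (U.map fun j => (a j, b j)) (by
      rw [le_principal_iff]
      exact Eventually.of_forall (f := (U : Filter ℕ)) fun j => ⟨(ha j).1, (hbw j).1⟩)
  have hlim : Tendsto (fun j => (a j, b j)) U (𝓝 (a₀, b₀)) := hlim
  have ha₀ := mem_feasibleWeights_of_tendsto ha hM.keyError_le hU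
    ((continuous_fst.tendsto _).comp hlim)
  have hb₀ := mem_feasibleWeights_of_tendsto hbw hM.nonkeyError_le hU
    ((continuous_snd.tendsto _).comp hlim)
  have hlim2 : Tendsto (fun j => (jsInfo p (a j) (b j) / p - Real.log (u j + 1) / n j)
      / Real.log 2) U (𝓝 (jsInfo p a₀ b₀ / p / Real.log 2)) := by
    have h3 := ((((continuous_jsInfo (p : ℝ)).tendsto (a₀, b₀)).comp hlim).div_const (p : ℝ)).sub
      ((tendsto_log_div_of_density hM.tendsto_n hM.tendsto_u (fun j => (hb j).1)
        (fun j => (hb j).2.2) hpR).mono_left hU)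
    rw [sub_zero] at h3
    exact h3.div_const _
  have hlt : c'' < ((jsInfo p a₀ b₀ / p / Real.log 2 : ℝ) : EReal) :=
    h2.trans_le (EReal.coe_le_coe_iff.2 (hc a₀ ha₀ b₀ hb₀))
  filter_upwards [((continuous_coe_real_ereal.tendsto _).comp hlim2).eventually
    (lt_mem_nhds hlt)] with j hj
  exact (le_of_lt hj).trans (hlow j)

/-- The single-letter information of any feasible pair is achieved as memory per key. -/
theorem exists_testerSequence {p : ℚ} (hp0 : 0 < p) (hp1 : p < 1) {a b : S → ℝ}
    (ha : a ∈ feasibleWeights (fun x : S => dK x) εK)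
    (hb : b ∈ feasibleWeights (fun x : S => dN x) εN) :
    ∃ (n u : ℕ → ℕ) (M : ∀ j, MembershipTester (u j) (n j)),
      IsTesterSequence dK dN εK εN S p n u M ∧
      limsup (fun j => (((M j).budget / (n j : ℝ≥0∞) : ℝ≥0∞) : EReal)) atTop
        ≤ ((jsInfo p a b / p / Real.log 2 : ℝ) : EReal) := by
  have hnum : 0 < p.num.natAbs := Int.natAbs_pos.2 (Rat.num_pos.2 hp0).ne'
  have hmul : ∀ k : ℕ, 0 < k → Tendsto (fun j : ℕ => (j + 1) * k) atTop atTop := fun k hk =>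
    tendsto_atTop_mono (fun j => (Nat.le_succ j).trans (Nat.le_mul_of_pos_right _ hk)) tendsto_id
  have hdens : ∀ j : ℕ, (((j + 1) * p.num.natAbs : ℕ) : ℚ) / (((j + 1) * p.den : ℕ) : ℚ) = p := by
    intro j
    have h1 : ((p.num.natAbs : ℕ) : ℚ) = p.num := by
      rw [← Int.cast_natCast, Int.natAbs_of_nonneg (Rat.num_pos.2 hp0).le]
    push_cast [h1]
    rw [mul_div_mul_left _ _ (by positivity), Rat.num_div_den]
  have hbd := fun j => density_bounds hp0 hp1 (hdens j)
  -- Multiples of numerator and denominator give density exactly `p`; the factor `j + 1` keeps the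
  -- sizes positive at `j = 0`.
  refine ⟨fun j => (j + 1) * p.num.natAbs, fun j => (j + 1) * p.den,
    fun j => MembershipTester.independentTester _ _ ha.1 hb.1, ⟨hmul _ hnum, hmul _ p.den_pos, hdens,
      fun j => MembershipTester.permutationInvariant_independentTester _ _,
      fun j => MembershipTester.outputsIn_independentTester _ _, ?_, ?_⟩, ?_⟩
  · refine limsup_le_of_le (by isBoundedDefault) (Eventually.of_forall fun j => ?_)
    rw [MembershipTester.keyError, MembershipTester.keyLaw_independentTester _ _ (hbd j).1
      (hbd j).2.1, lintegral_map_weightMeasure]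
    exact ha.2
  · refine limsup_le_of_le (by isBoundedDefault) (Eventually.of_forall fun j => ?_)
    rw [MembershipTester.nonkeyError, MembershipTester.nonkeyLaw_independentTester _ _ (hbd j).2.1,
      lintegral_map_weightMeasure]
    exact hb.2
  · refine limsup_le_of_le (by isBoundedDefault) (Eventually.of_forall fun j => ?_)
    obtain ⟨hn, hnu, hpj⟩ := hbd j
    have hpR : (0 : ℝ) < p := by exact_mod_cast hp0
    have hpI : (p : ℝ) ∈ Set.Ioo (0 : ℝ) 1 := ⟨hpR, by exact_mod_cast hp1⟩
    have h1 := MembershipTester.klDiv_jointLaw_independentTester_le ha.1 hb.1 hn hnu hpj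
    have h2 : (MembershipTester.independentTester ((j + 1) * p.den) ((j + 1) * p.num.natAbs)
        ha.1 hb.1).budget / (((j + 1) * p.num.natAbs : ℕ) : ℝ≥0∞)
        ≤ ENNReal.ofReal (jsInfo p a b / p / Real.log 2) := by
      have h3 : jsInfo p a b / p / Real.log 2 = (((j + 1) * p.den : ℕ) : ℝ) * jsInfo p a b
          / Real.log 2 / (((j + 1) * p.num.natAbs : ℕ) : ℝ) := by
        have hn' : (((j + 1) * p.num.natAbs : ℕ) : ℝ) ≠ 0 := by exact_mod_cast hn.ne'
        have hu' : (((j + 1) * p.den : ℕ) : ℝ) ≠ 0 := by exact_mod_cast (hn.trans hnu).ne'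
        generalize jsInfo (p : ℝ) a b = J
        rw [hpj]; field_simp
      rw [h3, ← ofReal_div_log_two_div hn, budget_div_eq]
      gcongr
    refine (EReal.coe_ennreal_le_coe_ennreal_iff.2 h2).trans_eq ?_
    rw [EReal.coe_ennreal_ofReal, max_eq_left]
    exact div_nonneg (div_nonneg (jsInfo_nonneg hpI ha.1 hb.1) hpR.le)
      (Real.log_pos one_lt_two).le

end Sequences

theorem theorem3p3 (dK dN : unitInterval → ℝ≥0∞) (hd : IsErrorMetricPair dK dN) (εK εN : ℝ≥0)
    (μK μN : ProbabilityMeasure unitInterval)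
    (hmin : IsUniqueKLMinimizer dK dN εK εN μK μN)
    (hfin : (μN : Measure unitInterval).support.Finite)
    (hchi : chiSqDiv (μK : Measure unitInterval) μN ≠ ∞) :
    ∃ r : ℝ → ℝ, r =o[𝓝[>] 0] (fun p : ℝ => p) ∧
      ∀ p : ℚ, 0 < p → p < 1 →
        (∀ (n u : ℕ → ℕ) (M : ∀ j, MembershipTester (u j) (n j)),
          IsTesterSequence dK dN εK εN (μN : Measure unitInterval).support p n u M →
          (((klBits (μK : Measure unitInterval) μN).toReal
              - (chiSqDiv (μK : Measure unitInterval) μN).toReal / (2 * Real.log 2) * (p : ℝ)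
              + r p : ℝ) : EReal)
            ≤ liminf (fun j => (((M j).budget / (n j : ℝ≥0∞) : ℝ≥0∞) : EReal)) atTop) ∧
        (∃ (n u : ℕ → ℕ) (M : ∀ j, MembershipTester (u j) (n j)),
          IsTesterSequence dK dN εK εN (μN : Measure unitInterval).support p n u M ∧
          limsup (fun j => (((M j).budget / (n j : ℝ≥0∞) : ℝ≥0∞) : EReal)) atTop
            ≤ (((klBits (μK : Measure unitInterval) μN).toReal
              - (chiSqDiv (μK : Measure unitInterval) μN).toReal / (2 * Real.log 2) * (p : ℝ)
              + r p : ℝ) : EReal)) := by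
  have hlog : 0 < Real.log 2 := Real.log_pos one_lt_two
  obtain ⟨S, hS⟩ : ∃ S : Finset unitInterval, (S : Set unitInterval)
      = (μN : Measure unitInterval).support := ⟨hfin.toFinset, hfin.coe_toFinset⟩
  have hN : (μN : Measure unitInterval) (S : Set unitInterval)ᶜ = 0 := by
    rw [hS]; exact Measure.measure_compl_support
  have hac : (μK : Measure unitInterval) ≪ μN := by
    by_contra h
    exact hchi (by rw [chiSqDiv, if_neg h])
  have hK : (μK : Measure unitInterval) (S : Set unitInterval)ᶜ = 0 := hac hN
  set a := weights S (μK : Measure unitInterval) with ha_def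
  set b := weights S (μN : Measure unitInterval) with hb_def
  have hpos : ∀ x, 0 < b x := fun x => by
    refine lt_of_le_of_ne measureReal_nonneg (Ne.symm ?_)
    rw [hb_def, weights, measureReal_def]
    refine ENNReal.toReal_ne_zero.2 ⟨?_, measure_ne_top _ _⟩
    exact measure_singleton_ne_zero_of_finite_support hfin (hS ▸ x.2)
  have ha : a ∈ feasibleWeights (fun x : S => dK x) εK :=
    weights_mem_feasibleWeights _ hK hmin.mem_key
  have hb : b ∈ feasibleWeights (fun x : S => dN x) εN :=
    weights_mem_feasibleWeights _ hN hmin.mem_nonkey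
  have hcA := isCompact_feasibleWeights (fun x : S => dK x) εK
  have hcB := isCompact_feasibleWeights (fun x : S => dN x) εN
  have hex := fun p : ℝ => (hcA.prod hcB).exists_isMinOn ⟨(a, b), ha, hb⟩
    (continuous_jsInfo p).continuousOn
  choose f hf hfmin using hex
  have hlittle := isLittleO_jsInfo_minimizer hcA hcB (fun _ h => h.1) (fun _ h => h.1) ha hb hpos
    (fun a' ha' b' hb' h => (klSum_weights_le hmin hK hN hac ha' hb' h).1)
    (fun a' ha' b' hb' h => (klSum_weights_le hmin hK hN hac ha' hb' h).2)
    (fun p _ => hf p) (fun p _ q hq => hfmin p hq)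
  have hkl : (klBits (μK : Measure unitInterval) μN).toReal = klSum a b / Real.log 2 := by
    rw [klBits, klDiv_eq_klSum hK hN hac, ENNReal.toReal_div, ENNReal.toReal_ofReal hlog.le,
      ENNReal.toReal_ofReal (klSum_nonneg ha.1 hb.1 fun x hx => absurd hx (hpos x).ne')]
  have hchiSum : (chiSqDiv (μK : Measure unitInterval) μN).toReal = chiSum a b := by
    rw [chiSqDiv_eq_chiSum hN hac, ENNReal.toReal_ofReal]
    exact Finset.sum_nonneg fun x _ => mul_nonneg (hpos x).le (sq_nonneg _)
  -- With the exact remainder as `r`, both bounds become statements about the minimum of `jsInfo`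
  -- itself, for every `p` and not only for small ones.
  refine ⟨fun p => (Real.log 2)⁻¹
    * (jsInfo p (f p).1 (f p).2 / p - klSum a b + chiSum a b / 2 * p),
    hlittle.const_mul_left _, fun p hp0 hp1 => ?_⟩
  have hval : (klBits (μK : Measure unitInterval) μN).toReal
      - (chiSqDiv (μK : Measure unitInterval) μN).toReal / (2 * Real.log 2) * (p : ℝ)
      + (Real.log 2)⁻¹ * (jsInfo p (f p).1 (f p).2 / p - klSum a b + chiSum a b / 2 * p)
      = jsInfo p (f p).1 (f p).2 / p / Real.log 2 := by
    rw [hkl, hchiSum]; ring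
  have hpR : (0 : ℝ) < p := by exact_mod_cast hp0
  rw [hval, ← hS]
  refine ⟨fun n u M hM => le_liminf_budget hp0 hp1 (fun a' ha' b' hb' => ?_) hM,
    exists_testerSequence hp0 hp1 (hf p).1 (hf p).2⟩
  have h1 : jsInfo p (f p).1 (f p).2 ≤ jsInfo p a' b' := hfmin p (Set.mk_mem_prod ha' hb')
  gcongr
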